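/- **Setting.** All Hilbert spaces are complex; $\mathcal G^*$ denotes the anti-dual (bounded conjugate-linear functionals) of a Hilbert space $\mathcal G$ and $\mathcal R_{\mathcal G}:\mathcal G\to\mathcal G^*$ the linear Riesz isomorphism; products carry the product Hilbert space norm. Inner products are linear in the first argument, $\langle\varphi,g\rangle_{\mathcal G^*,\mathcal G}=\varphi(g)$ and $\langle g,\varphi\rangle_{\mathcal G,\mathcal G^*}=\overline{\varphi(g)}$. Let $\mathcal X,\mathcal Y,\mathcal G_1,\mathcal G_2$ be Hilbert spaces. * $A:\mathcal X\supset\operatorname{dom}A\to\mathcal Y$ is closed and densely defined, and $S=A^*A$ is self-adjoint and uniformly positive ($\langle Sx,x\rangle\ge c\|x\|^2$ on $\operatorname{dom}S$ for some $c>0$). $\mathcal X_h$ is $\operatorname{dom}A$ with the inner product $\langle Ax,Ay\rangle_{\mathcal Y}$, and $\mathcal Y_1=\operatorname{ran}A$ with the inner product of $\mathcal Y$, so that $A:\mathcal X_h\to\mathcal Y_1$ is an isometric isomorphism. * $B:\mathcal Y\supset\operatorname{dom}B\to\mathcal X$ is closed and densely defined with $A^*\subset -B$, and $B_{\mathcal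 Y_1}$ is its restriction to $\operatorname{dom}B\cap\mathcal Y_1$, as an operator from $\mathcal Y_1$ to $\mathcal X$. * Linear maps $\Lambda=(\Lambda_1,\Lambda_2):\operatorname{dom}A\to\mathcal G_1\times\mathcal G_2^*$ and $\Pi=(\Pi_1,\Pi_2):\operatorname{dom}B\to\mathcal G_1^*\times\mathcal G_2$ form a boundary triplet for the dual pair $(A^*,-B^*)$: both are surjective and, for all $y\in\operatorname{dom}B$, $x\in\operatorname{dom}A$, $$-\langle By,x\rangle_{\mathcal X}-\langle y,Ax\rangle_{\mathcal Y}=\langle\Pi_1y,\Lambda_1x\rangle_{\mathcal G_1^*,\mathcal G_1}-\langle\Pi_2y,\Lambda_2x\rangle_{\mathcal G_2,\mathcal G_2^*}.$$ Put $\mathcal G=\mathcal G_1\times\mathcal G_2$ (with $\mathcal G^*=\mathcal G_1^*\times\mathcal G_2^*$) and, on $\operatorname{dom}B_{\mathcal Y_1}\times\operatorname{dom}A$, $\Xi_0(y,x)=(\Lambda_1x,\Pi_2y)\in\mathcal G$ and $\Xi_1(y,x)=(-\Pi_1y,\Lambda_2x)\in\mathcal G^*$. * $M\in L(\mathcal X)$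 is self-adjoint with $\langle Mx,x\rangle\ge\alpha\|x\|^2$ for some $\alpha>0$; $D\in L(\mathcal X)$ satisfies $\operatorname{Re}\langle Dx,x\rangle\ge0$; $\mathcal X_M$ is $\mathcal X$ with the inner product $\langle M^{-1}\cdot,\cdot\rangle_{\mathcal X}$; and $P\in L(\mathcal G^*)$ with $\|P\|\le1$. * $\mathcal A_M=\begin{bmatrix}0&M^{-1}\\B_{\mathcal Y_1}A&-DM^{-1}\end{bmatrix}$ in $\mathcal X_h\times\mathcal X_M$ with domain $\{(z_1,z_2): z_1\in\mathcal X_h,\ Az_1\in\operatorname{dom}B_{\mathcal Y_1},\ z_2\in M\mathcal X_h\}$. **Boundary nodes.** A colligation consists of Hilbert spaces $\mathcal U,\mathcal Z,\mathcal V$ and linear maps $G,L,K$ with a common domain in $\mathcal Z$ and values in $\mathcal U,\mathcal Z,\mathcal V$. It is an internally well-posed boundary node if $z\mapsto(Gz,Lz,Kz)$ is closed, $G$ is surjective, $\ker G$ is dense in $\mathcal Z$, and $L|_{\ker G}$ has non-empty resolvent set and generates a strongly continuous semigroup on $\mathcal Z$. Such a node is scattering passive if $\frac{\mathrm d}{\mathrm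 dt}\|z\|^2+\|y\|^2\le\|u\|^2$ on $[0,\infty)$ for all smooth solutions of $u=Gz$, $\dot z=Lz$, $y=Kz$ (that is, $u\in C^2$, and $z$ is $C^1$ into $\mathcal Z$ and continuous into the domain with the graph norm). A colligation with $\mathcal U=\mathcal V$ is impedance passive if for some $\beta$ with $\operatorname{Re}\beta>0$ the colligation with the same domain and $L$, and with $G,K$ replaced by $\frac{1}{\sqrt{2\operatorname{Re}\beta}}(\beta G+K)$ and $\frac{1}{\sqrt{2\operatorname{Re}\beta}}(\overline\beta G-K)$, is a scattering passive boundary node. **Theorem.** 1. $\mathcal X_h$ is $\operatorname{dom}S^{1/2}$ with the norm $\|S^{1/2}\cdot\|_{\mathcal X}$: if $R$ is a nonnegative self-adjoint operator with $R^2=S$, then $\operatorname{dom}R=\operatorname{dom}A$ and $\|Rx\|=\|Ax\|$ there. 2. Conjugating $\mathcal A_M$ by the isometric isomorphism $\operatorname{diag}(A,I):\mathcal X_h\times\mathcal X_M\to\mathcal Y_1\times\mathcal X_M$ gives $$\operatorname{diag}(A,I)\,\mathcal A_M\,\operatorname{diag}(A^{-1},I)=\mathcal B_M:=\begin{bmatrix}0&AM^{-1}\\B_{\mathcal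 Y_1}&-DM^{-1}\end{bmatrix},\qquad \operatorname{dom}\mathcal B_M=\{(y,w): y\in\operatorname{dom}B_{\mathcal Y_1},\ M^{-1}w\in\operatorname{dom}A\}.$$ 3. The colligation with input and output space $\mathcal G^*$, state space $\mathcal Y_1\times\mathcal X_M$, domain $\operatorname{dom}\mathcal B_M$, interior operator $\mathcal B_M$, input map $\tfrac12\big((1-P)\mathcal R_{\mathcal G}\Xi_0+(1+P)\Xi_1\big)\operatorname{diag}(I,M^{-1})$ and output map $\tfrac12\big((1+P)\mathcal R_{\mathcal G}\Xi_0+(1-P)\Xi_1\big)\operatorname{diag}(I,M^{-1})$ is an impedance passive, internally well-posed boundary node. -/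

import Mathlib

open Topology Filter
open scoped NNReal

noncomputable section

namespace BoundaryNode

/-! ### Anti-duals of complex Hilbert spaces -/

/-- The anti-dual of `G`: bounded conjugate-linear functionals, with the operator norm.
The pairing `⟨φ, g⟩` of `φ` in the anti-dual with `g` in `G` is `φ g`
(linear in `φ`, conjugate-linear in `g`). -/
abbrev AntiDual (G : Type*) [NormedAddCommGroup G] [InnerProductSpace ℂ G] : Type _ :=
  G →L⋆[ℂ] ℂ

section AntiDual

variable (G : Type*) [NormedAddCommGroup G] [InnerProductSpace ℂ G]

/-- The linear isometry `g ↦ ⟨g, ·⟩` into the anti-dual. (Mathlib's `inner ℂ x g` is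
conjugate-linear in `x` and linear in `g`.) -/
def rieszMap : G →ₗᵢ[ℂ] AntiDual G where
  toLinearMap := (innerSLFlip ℂ : G →L[ℂ] G →L⋆[ℂ] ℂ)
  norm_map' g := by
    refine le_antisymm ?_ ?_
    · refine ContinuousLinearMap.opNorm_le_bound _ (norm_nonneg _) fun x => ?_
      simpa [mul_comm] using norm_inner_le_norm (𝕜 := ℂ) x g
    · rcases eq_or_ne g 0 with rfl | hg
      · simp
      · have h := ContinuousLinearMap.le_opNorm
          ((innerSLFlip ℂ : G →L[ℂ] G →L⋆[ℂ] ℂ) g) g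
        have h2 : ‖((innerSLFlip ℂ : G →L[ℂ] G →L⋆[ℂ] ℂ) g) g‖ = ‖g‖ * ‖g‖ := by
          simp [inner_self_eq_norm_sq_to_K, pow_two]
        rw [h2] at h
        exact le_of_mul_le_mul_right h (norm_pos_iff.mpr hg)

variable [CompleteSpace G]

theorem rieszMap_surjective : Function.Surjective (rieszMap G) := by
  intro φ
  let ψ : StrongDual ℂ G :=
    { toFun := fun x => starRingEnd ℂ (φ x)
      map_add' := fun x y => by simp
      map_smul' := fun c x => by simp
      cont := Complex.continuous_conj.comp φ.continuous }
  refine ⟨(InnerProductSpace.toDual ℂ G).symm ψ, ?_⟩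
  ext x
  have h : inner ℂ ((InnerProductSpace.toDual ℂ G).symm ψ) x = starRingEnd ℂ (φ x) :=
    InnerProductSpace.toDual_symm_apply
  change inner ℂ x ((InnerProductSpace.toDual ℂ G).symm ψ) = φ x
  rw [← inner_conj_symm, h, Complex.conj_conj]

/-- The linear Riesz isomorphism from a Hilbert space onto its anti-dual. -/
def riesz : G ≃ₗᵢ[ℂ] AntiDual G :=
  LinearIsometryEquiv.ofSurjective (rieszMap G) (rieszMap_surjective G)

/-- The Hilbert space structure of the anti-dual, inducing the operator norm. -/
instance instInnerProductSpaceAntiDual : InnerProductSpace ℂ (AntiDual G) where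
  inner φ ψ := inner ℂ ((riesz G).symm φ) ((riesz G).symm ψ)
  norm_sq_eq_re_inner φ := by
    rw [← norm_sq_eq_re_inner (𝕜 := ℂ) ((riesz G).symm φ), LinearIsometryEquiv.norm_map]
  conj_inner_symm φ ψ := inner_conj_symm _ _
  add_left φ ψ χ := by simp only [map_add, inner_add_left]
  smul_left φ ψ c := by simp only [map_smul, inner_smul_left]

end AntiDual

/-- The identification of `G₁* × G₂*` with the anti-dual of the Hilbert space product `G₁ × G₂`:
`⟨(φ, ψ), (g₁, g₂)⟩ = ⟨φ, g₁⟩ + ⟨ψ, g₂⟩`. -/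
def antiDualProd (G₁ G₂ : Type*) [NormedAddCommGroup G₁] [InnerProductSpace ℂ G₁]
    [NormedAddCommGroup G₂] [InnerProductSpace ℂ G₂] :
    (AntiDual G₁ × AntiDual G₂) →ₗ[ℂ] AntiDual (WithLp 2 (G₁ × G₂)) where
  toFun φ := φ.1.comp (WithLp.fstL 2 ℂ G₁ G₂) + φ.2.comp (WithLp.sndL 2 ℂ G₁ G₂)
  map_add' φ ψ := by ext g; simp; ring
  map_smul' c φ := by ext g; simp

/-! ### Unbounded operators -/

section Unbounded

variable {X Y Z : Type*} [NormedAddCommGroup X] [InnerProductSpace ℂ X]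
  [NormedAddCommGroup Y] [InnerProductSpace ℂ Y] [NormedAddCommGroup Z] [InnerProductSpace ℂ Z]

/-- The product `g ∘ f` of unbounded operators on its maximal domain
`{x ∈ dom f | f x ∈ dom g}`. -/
def pmapComp (g : Y →ₗ.[ℂ] Z) (f : X →ₗ.[ℂ] Y) : X →ₗ.[ℂ] Z where
  domain :=
    { carrier := {x | ∃ h : x ∈ f.domain, f ⟨x, h⟩ ∈ g.domain}
      zero_mem' := ⟨f.domain.zero_mem, by
        have : f ⟨0, f.domain.zero_mem⟩ = 0 := f.map_zero
        rw [this]; exact g.domain.zero_mem⟩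
      add_mem' := by
        rintro a b ⟨ha, ha'⟩ ⟨hb, hb'⟩
        refine ⟨f.domain.add_mem ha hb, ?_⟩
        have : f ⟨a + b, f.domain.add_mem ha hb⟩ = f ⟨a, ha⟩ + f ⟨b, hb⟩ :=
          f.map_add ⟨a, ha⟩ ⟨b, hb⟩
        rw [this]; exact g.domain.add_mem ha' hb'
      smul_mem' := by
        rintro c a ⟨ha, ha'⟩
        refine ⟨f.domain.smul_mem c ha, ?_⟩
        have : f ⟨c • a, f.domain.smul_mem c ha⟩ = c • f ⟨a, ha⟩ := f.map_smul c ⟨a, ha⟩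
        rw [this]; exact g.domain.smul_mem c ha' }
  toFun :=
    { toFun := fun x => g ⟨f ⟨x.1, x.2.1⟩, x.2.2⟩
      map_add' := fun x y => by
        rw [← g.map_add]
        exact congrArg g (Subtype.ext (f.map_add ⟨x.1, x.2.1⟩ ⟨y.1, y.2.1⟩))
      map_smul' := fun c x => by
        rw [RingHom.id_apply, ← g.map_smul]
        exact congrArg g (Subtype.ext (f.map_smul c ⟨x.1, x.2.1⟩)) }

/-- The similarity transform `e T e⁻¹` of an unbounded operator, with domain `e (dom T)`. -/
def conjugate (e : X ≃ₗ[ℂ] Y) (T : X →ₗ.[ℂ] X) : Y →ₗ.[ℂ] Y where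
  domain := T.domain.comap (e.symm : Y →ₗ[ℂ] X)
  toFun := (e : X →ₗ[ℂ] Y) ∘ₗ T.toFun ∘ₗ
    LinearMap.submoduleComap (e.symm : Y →ₗ[ℂ] X) T.domain

/-- The form `x ↦ ⟨x, S x⟩` of the operator `S` is coercive. -/
def HasCoerciveForm (S : X →ₗ.[ℂ] X) : Prop :=
  ∃ c : ℝ, 0 < c ∧ ∀ x : S.domain, c * ‖(x : X)‖ ^ 2 ≤ RCLike.re (inner ℂ (x : X) (S x))

/-- A self-adjoint (possibly unbounded) operator with coercive form. -/
def IsUniformlyPositive [CompleteSpace X] (S : X →ₗ.[ℂ] X) : Prop :=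
  IsSelfAdjoint S ∧ HasCoerciveForm S

/-- A bounded self-adjoint operator with coercive form. -/
def IsBddUniformlyPositive [CompleteSpace X] (M : X →L[ℂ] X) : Prop :=
  IsSelfAdjoint M ∧ ∃ c : ℝ, 0 < c ∧ ∀ x : X, c * ‖x‖ ^ 2 ≤ RCLike.re (inner ℂ x (M x))

/-- `R` is the nonnegative self-adjoint square root of the unbounded operator `S`. -/
def IsSqrtOf [CompleteSpace X] (R S : X →ₗ.[ℂ] X) : Prop :=
  IsSelfAdjoint R ∧ (∀ x : R.domain, 0 ≤ RCLike.re (inner ℂ (x : X) (R x))) ∧ pmapComp R R = S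

/-- The resolvent set: `μ - A` is a bijection from `dom A` onto the space, with bounded inverse. -/
def resolventSet (A : X →ₗ.[ℂ] X) : Set ℂ :=
  {μ | ∃ R : X →L[ℂ] X, (∀ x : X, ∃ h : R x ∈ A.domain, μ • R x - A ⟨R x, h⟩ = x) ∧
    ∀ z : A.domain, R (μ • (z : X) - A z) = z}

end Unbounded

/-- A strongly continuous one-parameter semigroup of bounded operators on `X`. -/
structure C0Semigroup (X : Type*) [NormedAddCommGroup X] [InnerProductSpace ℂ X] where
  toFun : ℝ≥0 → X →L[ℂ] X
  map_zero : toFun 0 = ContinuousLinearMap.id ℂ X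
  map_add : ∀ s t, toFun (s + t) = (toFun s).comp (toFun t)
  continuous_orbit : ∀ x, Continuous fun t => toFun t x

/-- `A` is the generator of `T`: `x ∈ dom A` and `A x = y` if and only if
`(T(t) x - x) / t → y` as `t ↓ 0`. -/
def C0Semigroup.IsGenerator {X : Type*} [NormedAddCommGroup X] [InnerProductSpace ℂ X]
    (T : C0Semigroup X) (A : X →ₗ.[ℂ] X) : Prop :=
  ∀ x y : X, (x, y) ∈ A.graph ↔
    Tendsto (fun t : ℝ≥0 => ((t : ℝ) : ℂ)⁻¹ • (T.toFun t x - x)) (𝓝[>] 0) (𝓝 y)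

/-! ### Colligations and boundary nodes -/

/-- A colligation: three linear maps `G`, `L`, `K` with a common domain in the state space `X`
and with values in `U`, `X` and `Y`. -/
structure Colligation (U X Y : Type*) [NormedAddCommGroup U] [InnerProductSpace ℂ U]
    [NormedAddCommGroup X] [InnerProductSpace ℂ X]
    [NormedAddCommGroup Y] [InnerProductSpace ℂ Y] where
  dom : Submodule ℂ X
  G : dom →ₗ[ℂ] U
  L : dom →ₗ[ℂ] X
  K : dom →ₗ[ℂ] Y

namespace Colligation

section Node

variable {U X Y : Type*} [NormedAddCommGroup U] [InnerProductSpace ℂ U]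
  [NormedAddCommGroup X] [InnerProductSpace ℂ X]
  [NormedAddCommGroup Y] [InnerProductSpace ℂ Y]

/-- The combined operator `z ↦ (G z, L z, K z)`. -/
def combined (Θ : Colligation U X Y) : X →ₗ.[ℂ] U × X × Y :=
  ⟨Θ.dom, Θ.G.prod (Θ.L.prod Θ.K)⟩

/-- The restriction of the interior operator `L` to `ker G`. -/
def mainOperator (Θ : Colligation U X Y) : X →ₗ.[ℂ] X :=
  LinearPMap.domRestrict ⟨Θ.dom, Θ.L⟩ ((LinearMap.ker Θ.G).map Θ.dom.subtype)

/-- Boundary nodes. The first three clauses say that the spaces are Hilbert spaces. -/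
structure IsBoundaryNode (Θ : Colligation U X Y) : Prop where
  complete_input : CompleteSpace U
  complete_state : CompleteSpace X
  complete_output : CompleteSpace Y
  closed : Θ.combined.IsClosed
  surjective : Function.Surjective Θ.G
  dense_ker : Dense (((LinearMap.ker Θ.G).map Θ.dom.subtype : Submodule ℂ X) : Set X)
  resolvent : (resolventSet Θ.mainOperator).Nonempty

/-- Internally well-posed boundary nodes: the main operator generates a strongly continuous
semigroup. -/
structure IsInternallyWellPosed (Θ : Colligation U X Y) : Prop extends Θ.IsBoundaryNode where
  generator : ∃ T : C0Semigroup X, T.IsGenerator Θ.mainOperator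

/-- `(u, z, y)` is a smooth solution on `[0, ∞)` of `u = G z`, `z' = L z`, `y = K z`:
`u` is `C²`, `z` is `C¹` into the state space and continuous into the domain with its graph norm.
(Only the values at `t ≥ 0` matter.) -/
structure IsSmoothSolution (Θ : Colligation U X Y)
    (u : ℝ → U) (z : ℝ → Θ.dom) (y : ℝ → Y) : Prop where
  input_C2 : ContDiffOn ℝ 2 u (Set.Ici 0)
  state_C1 : ContDiffOn ℝ 1 (fun t => (z t : X)) (Set.Ici 0)
  continuous_graphNorm :
    ContinuousOn (fun t => ((z t : X), Θ.combined (z t))) (Set.Ici 0)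
  input_eq : ∀ t, 0 ≤ t → u t = Θ.G (z t)
  state_eq : ∀ t, 0 ≤ t → HasDerivWithinAt (fun s => (z s : X)) (Θ.L (z t)) (Set.Ici 0) t
  output_eq : ∀ t, 0 ≤ t → y t = Θ.K (z t)

/-- Scattering passive boundary nodes: internally well-posed, and
`d/dt ‖z(t)‖² + ‖y(t)‖² ≤ ‖u(t)‖²` along all smooth solutions. -/
structure IsScatteringPassive (Θ : Colligation U X Y) : Prop
    extends Θ.IsInternallyWellPosed where
  passive : ∀ u z y, Θ.IsSmoothSolution u z y → ∀ t, 0 ≤ t →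
    derivWithin (fun s => ‖(z s : X)‖ ^ 2) (Set.Ici 0) t + ‖y t‖ ^ 2 ≤ ‖u t‖ ^ 2

end Node

section Impedance

variable {U X : Type*} [NormedAddCommGroup U] [InnerProductSpace ℂ U]
  [NormedAddCommGroup X] [InnerProductSpace ℂ X]

/-- The external Cayley transform with parameter `β`, `Re β > 0`. -/
def cayley (Θ : Colligation U X U) (β : ℂ) : Colligation U X U where
  dom := Θ.dom
  G := ((1 / Real.sqrt (2 * β.re) : ℝ) : ℂ) • (β • Θ.G + Θ.K)
  L := Θ.L
  K := ((1 / Real.sqrt (2 * β.re) : ℝ) : ℂ) • (starRingEnd ℂ β • Θ.G - Θ.K)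

/-- Impedance passivity: some external Cayley transform is a scattering passive boundary node. -/
def IsImpedancePassive (Θ : Colligation U X U) : Prop :=
  ∃ β : ℂ, 0 < β.re ∧ (Θ.cayley β).IsScatteringPassive

end Impedance

end Colligation

/-! ### The second-order setting -/

section Setting

variable {X Y : Type*} [NormedAddCommGroup X] [InnerProductSpace ℂ X] [CompleteSpace X]
  [NormedAddCommGroup Y] [InnerProductSpace ℂ Y]

/-- The stiffness operator `S = A* A`. -/
def stiffness (A : X →ₗ.[ℂ] Y) : X →ₗ.[ℂ] X := pmapComp A.adjoint A

theorem eq_zero_of_apply_eq_zero {A : X →ₗ.[ℂ] Y} (hS : IsUniformlyPositive (stiffness A))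
    (x : A.domain) (hx : A x = 0) : x = 0 := by
  obtain ⟨c, hc, h⟩ := hS.2
  have hx' : A ⟨x.1, x.2⟩ ∈ A.adjoint.domain := by
    have : A ⟨x.1, x.2⟩ = 0 := hx
    rw [this]; exact Submodule.zero_mem _
  have h1 := h ⟨x.1, x.2, hx'⟩
  have h2 : stiffness A ⟨x.1, x.2, hx'⟩ = 0 := by
    have h3 : (⟨A ⟨x.1, x.2⟩, hx'⟩ : A.adjoint.domain) = 0 := Subtype.ext hx
    change A.adjoint ⟨A ⟨x.1, x.2⟩, hx'⟩ = 0
    rw [h3]; exact A.adjoint.map_zero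
  rw [h2, inner_zero_right] at h1
  have h4 : ‖(x : X)‖ ^ 2 ≤ 0 := by
    by_contra h5
    have := mul_pos hc (not_le.mp h5)
    simp at h1
    linarith
  have h5 : ‖(x : X)‖ = 0 := by nlinarith [norm_nonneg (x : X)]
  exact Subtype.ext (norm_eq_zero.mp h5)

/-- The energy space `X_h`: the domain of `A` (which is the domain of `S^{1/2}`), with
inner product `h(x, y) = ⟨A x, A y⟩`. -/
def EnergySpace (A : X →ₗ.[ℂ] Y) (_hS : IsUniformlyPositive (stiffness A)) : Type _ := A.domain

namespace EnergySpace

variable (A : X →ₗ.[ℂ] Y) (hS : IsUniformlyPositive (stiffness A))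

instance : AddCommGroup (EnergySpace A hS) := inferInstanceAs (AddCommGroup A.domain)

instance : Module ℂ (EnergySpace A hS) := inferInstanceAs (Module ℂ A.domain)

/-- The identity from `dom A` to the energy space. -/
def of : A.domain ≃ₗ[ℂ] EnergySpace A hS := LinearEquiv.refl ℂ A.domain

/-- The inner product of the energy space. -/
@[reducible]
def core : InnerProductSpace.Core ℂ (EnergySpace A hS) where
  inner x y := inner ℂ (A ((of A hS).symm x)) (A ((of A hS).symm y))
  conj_inner_symm x y := inner_conj_symm _ _
  re_inner_nonneg x := inner_self_nonneg
  add_left x y z := by rw [map_add, A.map_add, inner_add_left]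
  smul_left x y c := by rw [map_smul, A.map_smul, inner_smul_left]
  definite x hx := by
    have h := eq_zero_of_apply_eq_zero hS ((of A hS).symm x) (inner_self_eq_zero.mp hx)
    simpa using h

instance : NormedAddCommGroup (EnergySpace A hS) := (core A hS).toNormedAddCommGroup

instance : InnerProductSpace ℂ (EnergySpace A hS) := InnerProductSpace.ofCore (core A hS).toCore

end EnergySpace

/-- The strain space `Y₁ = ran A`, with the inner product of `Y`. -/
abbrev StrainSpace (A : X →ₗ.[ℂ] Y) : Type _ := LinearMap.range A.toFun

/-- The isometric isomorphism `A : X_h → Y₁`. -/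
def strainIso (A : X →ₗ.[ℂ] Y) (hS : IsUniformlyPositive (stiffness A)) :
    EnergySpace A hS ≃ₗᵢ[ℂ] StrainSpace A where
  toLinearEquiv := LinearEquiv.ofBijective
    (A.toFun.rangeRestrict ∘ₗ ((EnergySpace.of A hS).symm : EnergySpace A hS →ₗ[ℂ] A.domain)) (by
      constructor
      · rw [injective_iff_map_eq_zero]
        intro x hx
        have h := eq_zero_of_apply_eq_zero hS ((EnergySpace.of A hS).symm x)
          (congrArg Subtype.val hx)
        simpa using h
      · exact A.toFun.surjective_rangeRestrict.comp (EnergySpace.of A hS).symm.surjective)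
  norm_map' x := by
    rw [norm_eq_sqrt_re_inner (𝕜 := ℂ) x, norm_eq_sqrt_re_inner (𝕜 := ℂ)]
    rfl

/-- The operator `M⁻¹`. -/
def massInv (M : X →L[ℂ] X) : X →L[ℂ] X := Ring.inverse M

theorem mass_massInv {M : X →L[ℂ] X} (hM : IsBddUniformlyPositive M) (x : X) :
    M (massInv M x) = x := by
  obtain ⟨c, hc, h⟩ := hM.2
  have hu : IsUnit M := by
    refine ContinuousLinearMap.isUnit_of_forall_le_norm_inner_map M (c := ⟨c, hc.le⟩) hc
      fun x => ?_
    have h1 := (h x).trans (RCLike.re_le_norm _)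
    rw [norm_inner_symm] at h1
    change ‖x‖ ^ 2 * c ≤ _
    linarith
  have h2 := Ring.mul_inverse_cancel M hu
  exact congrArg (fun T : X →L[ℂ] X => T x) h2

/-- The momentum space `X_M`: the space `X` with the inner product `⟨M⁻¹ x, y⟩`. -/
def MomentumSpace (M : X →L[ℂ] X) (_hM : IsBddUniformlyPositive M) : Type _ := X

namespace MomentumSpace

variable (M : X →L[ℂ] X) (hM : IsBddUniformlyPositive M)

instance : AddCommGroup (MomentumSpace M hM) := inferInstanceAs (AddCommGroup X)

instance : Module ℂ (MomentumSpace M hM) := inferInstanceAs (Module ℂ X)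

/-- The identity from `X` to the momentum space. -/
def of : X ≃ₗ[ℂ] MomentumSpace M hM := LinearEquiv.refl ℂ X

/-- The inner product of the momentum space. -/
@[reducible]
def core : InnerProductSpace.Core ℂ (MomentumSpace M hM) where
  inner x y := inner ℂ ((of M hM).symm x) (massInv M ((of M hM).symm y))
  conj_inner_symm x y := by
    have h := ContinuousLinearMap.isSelfAdjoint_iff_isSymmetric.mp hM.1
      (massInv M ((of M hM).symm x)) (massInv M ((of M hM).symm y))
    simp only [ContinuousLinearMap.coe_coe, mass_massInv hM] at h
    rw [inner_conj_symm, h]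
  re_inner_nonneg x := by
    obtain ⟨c, hc, h⟩ := hM.2
    have h1 := h (massInv M ((of M hM).symm x))
    rw [mass_massInv hM] at h1
    rw [inner_re_symm]
    exact le_trans (by positivity) h1
  add_left x y z := by rw [map_add, inner_add_left]
  smul_left x y c := by rw [map_smul, inner_smul_left]
  definite x hx := by
    obtain ⟨c, hc, h⟩ := hM.2
    have h1 := h (massInv M ((of M hM).symm x))
    rw [mass_massInv hM, inner_re_symm] at h1
    have hx' : inner ℂ ((of M hM).symm x) (massInv M ((of M hM).symm x)) = 0 := hx
    rw [hx'] at h1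
    have h2 : massInv M ((of M hM).symm x) = 0 := by
      by_contra h3
      have := mul_pos hc (pow_pos (norm_pos_iff.mpr h3) 2)
      simp at h1
      linarith
    have h3 := mass_massInv hM ((of M hM).symm x)
    rw [h2, map_zero] at h3
    simpa using h3.symm

instance : NormedAddCommGroup (MomentumSpace M hM) := (core M hM).toNormedAddCommGroup

instance : InnerProductSpace ℂ (MomentumSpace M hM) :=
  InnerProductSpace.ofCore (core M hM).toCore

end MomentumSpace

/-- The restriction `B_{Y₁}` of `B` to `dom B ∩ Y₁`, as an operator from `Y₁` to `X`. -/
def strainRestrict (A : X →ₗ.[ℂ] Y) (B : Y →ₗ.[ℂ] X) : StrainSpace A →ₗ.[ℂ] X where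
  domain := B.domain.comap (LinearMap.range A.toFun).subtype
  toFun := B.toFun ∘ₗ LinearMap.submoduleComap (LinearMap.range A.toFun).subtype B.domain

section Operators

variable (A : X →ₗ.[ℂ] Y) (B : Y →ₗ.[ℂ] X) (M D : X →L[ℂ] X)
  (hS : IsUniformlyPositive (stiffness A)) (hM : IsBddUniformlyPositive M)

/-- The second component `z₂ ↦ M⁻¹ z₂`, as a map from `X_M` to `X`. -/
def velocity : MomentumSpace M hM →ₗ[ℂ] X :=
  (massInv M : X →ₗ[ℂ] X) ∘ₗ ((MomentumSpace.of M hM).symm : MomentumSpace M hM →ₗ[ℂ] X)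

/-- The domain `{(z₁, z₂) | A z₁ ∈ dom B_{Y₁}, M⁻¹ z₂ ∈ dom A}` in `X_h × X_M`. -/
abbrev positionMomentumDomain :
    Submodule ℂ (WithLp 2 (EnergySpace A hS × MomentumSpace M hM)) :=
  (strainRestrict A B).domain.comap
      ((strainIso A hS).toLinearEquiv.toLinearMap ∘ₗ WithLp.fstₗ 2 ℂ _ _) ⊓
    A.domain.comap (velocity M hM ∘ₗ WithLp.sndₗ 2 ℂ _ _)

/-- The position–momentum operator `[[0, M⁻¹], [B_{Y₁} A, -D M⁻¹]]` in `X_h × X_M`. -/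
def positionMomentum :
    WithLp 2 (EnergySpace A hS × MomentumSpace M hM) →ₗ.[ℂ]
      WithLp 2 (EnergySpace A hS × MomentumSpace M hM) where
  domain := positionMomentumDomain A B M hS hM
  toFun :=
    let a := LinearMap.restrict ((strainIso A hS).toLinearEquiv.toLinearMap ∘ₗ
      WithLp.fstₗ 2 ℂ (EnergySpace A hS) (MomentumSpace M hM))
      fun z (h : z ∈ positionMomentumDomain A B M hS hM) => h.1
    let v := LinearMap.restrict (velocity M hM ∘ₗ
      WithLp.sndₗ 2 ℂ (EnergySpace A hS) (MomentumSpace M hM))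
      fun z (h : z ∈ positionMomentumDomain A B M hS hM) => h.2
    (WithLp.linearEquiv 2 ℂ (EnergySpace A hS × MomentumSpace M hM)).symm.toLinearMap ∘ₗ
      ((EnergySpace.of A hS).toLinearMap ∘ₗ v).prod
        ((MomentumSpace.of M hM).toLinearMap ∘ₗ
          ((strainRestrict A B).toFun ∘ₗ a - D.toLinearMap ∘ₗ A.domain.subtype ∘ₗ v))

theorem positionMomentum_apply (z : (positionMomentum A B M D hS hM).domain) :
    positionMomentum A B M D hS hM z = WithLp.toLp 2
      (EnergySpace.of A hS ⟨velocity M hM z.1.snd, z.2.2⟩,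
        MomentumSpace.of M hM
          (strainRestrict A B ⟨strainIso A hS z.1.fst, z.2.1⟩ - D (velocity M hM z.1.snd))) :=
  rfl

/-- The domain `{(y, w) | y ∈ dom B_{Y₁}, M⁻¹ w ∈ dom A}` in `Y₁ × X_M`. -/
abbrev strainMomentumDomain : Submodule ℂ (WithLp 2 (StrainSpace A × MomentumSpace M hM)) :=
  (strainRestrict A B).domain.comap (WithLp.fstₗ 2 ℂ _ _) ⊓
    A.domain.comap (velocity M hM ∘ₗ WithLp.sndₗ 2 ℂ _ _)

/-- The strain–momentum operator `[[0, A M⁻¹], [B_{Y₁}, -D M⁻¹]]` in `Y₁ × X_M`. -/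
def strainMomentum :
    WithLp 2 (StrainSpace A × MomentumSpace M hM) →ₗ.[ℂ]
      WithLp 2 (StrainSpace A × MomentumSpace M hM) where
  domain := strainMomentumDomain A B M hM
  toFun :=
    let a := LinearMap.restrict
      (WithLp.fstₗ 2 ℂ (StrainSpace A) (MomentumSpace M hM))
      fun z (h : z ∈ strainMomentumDomain A B M hM) => h.1
    let v := LinearMap.restrict (velocity M hM ∘ₗ
      WithLp.sndₗ 2 ℂ (StrainSpace A) (MomentumSpace M hM))
      fun z (h : z ∈ strainMomentumDomain A B M hM) => h.2
    (WithLp.linearEquiv 2 ℂ (StrainSpace A × MomentumSpace M hM)).symm.toLinearMap ∘ₗ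
      (A.toFun.rangeRestrict ∘ₗ v).prod
        ((MomentumSpace.of M hM).toLinearMap ∘ₗ
          ((strainRestrict A B).toFun ∘ₗ a - D.toLinearMap ∘ₗ A.domain.subtype ∘ₗ v))

theorem strainMomentum_apply (w : (strainMomentum A B M D hM).domain) :
    strainMomentum A B M D hM w = WithLp.toLp 2
      (A.toFun.rangeRestrict ⟨velocity M hM w.1.snd, w.2.2⟩,
        MomentumSpace.of M hM
          (strainRestrict A B ⟨w.1.fst, w.2.1⟩ - D (velocity M hM w.1.snd))) :=
  rfl

/-- The isometric isomorphism `diag(A, I) : X_h × X_M → Y₁ × X_M`. -/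
def diagIso :
    WithLp 2 (EnergySpace A hS × MomentumSpace M hM) ≃ₗᵢ[ℂ]
      WithLp 2 (StrainSpace A × MomentumSpace M hM) :=
  LinearIsometryEquiv.withLpProdCongr 2 (strainIso A hS) (LinearIsometryEquiv.refl ℂ _)

end Operators

/-- A boundary triplet `(G₁ × G₂, lam, pi)` for the dual pair `(A*, -B*)`, where `A` and `B` are closed
and densely defined, so that `A** = A` and `(-B*)* = -B`. Pairings of `g` in `G` with `φ` in its
anti-dual are `⟨φ, g⟩ = φ g` and `⟨g, φ⟩ = conj (φ g)`; in Mathlib's convention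
`⟨y, A x⟩ = inner ℂ (A x) y`. -/
structure DualPairTriplet (A : X →ₗ.[ℂ] Y) (B : Y →ₗ.[ℂ] X) (G₁ G₂ : Type*)
    [NormedAddCommGroup G₁] [InnerProductSpace ℂ G₁]
    [NormedAddCommGroup G₂] [InnerProductSpace ℂ G₂] where
  lam₁ : A.domain →ₗ[ℂ] G₁
  lam₂ : A.domain →ₗ[ℂ] AntiDual G₂
  pi₁ : B.domain →ₗ[ℂ] AntiDual G₁
  pi₂ : B.domain →ₗ[ℂ] G₂
  surjective_lam : Function.Surjective (lam₁.prod lam₂)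
  surjective_pi : Function.Surjective (pi₁.prod pi₂)
  green : ∀ (y : B.domain) (x : A.domain),
    -inner ℂ (x : X) (B y) - inner ℂ (A x) (y : Y) =
      pi₁ y (lam₁ x) - starRingEnd ℂ (lam₂ x (pi₂ y))

namespace DualPairTriplet

variable {A : X →ₗ.[ℂ] Y} {B : Y →ₗ.[ℂ] X} {G₁ G₂ : Type*}
  [NormedAddCommGroup G₁] [InnerProductSpace ℂ G₁]
  [NormedAddCommGroup G₂] [InnerProductSpace ℂ G₂]

/-- The inclusion of `dom B_{Y₁}` in `dom B`. -/
def inclB (A : X →ₗ.[ℂ] Y) (B : Y →ₗ.[ℂ] X) : (strainRestrict A B).domain →ₗ[ℂ] B.domain :=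
  LinearMap.submoduleComap (LinearMap.range A.toFun).subtype B.domain

/-- The boundary map `Ξ₀ (y, x) = (lam₁ x, pi₂ y)` on `dom B_{Y₁} × dom A`. -/
def Ξ₀ (t : DualPairTriplet A B G₁ G₂) :
    ((strainRestrict A B).domain × A.domain) →ₗ[ℂ] WithLp 2 (G₁ × G₂) :=
  (WithLp.linearEquiv 2 ℂ (G₁ × G₂)).symm.toLinearMap ∘ₗ
    (t.lam₁ ∘ₗ LinearMap.snd ℂ _ _).prod (t.pi₂ ∘ₗ inclB A B ∘ₗ LinearMap.fst ℂ _ _)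

/-- The boundary map `Ξ₁ (y, x) = (-pi₁ y, lam₂ x)` on `dom B_{Y₁} × dom A`. -/
def Ξ₁ (t : DualPairTriplet A B G₁ G₂) :
    ((strainRestrict A B).domain × A.domain) →ₗ[ℂ] AntiDual (WithLp 2 (G₁ × G₂)) :=
  antiDualProd G₁ G₂ ∘ₗ
    (-(t.pi₁ ∘ₗ inclB A B ∘ₗ LinearMap.fst ℂ _ _)).prod (t.lam₂ ∘ₗ LinearMap.snd ℂ _ _)

/-- The map `diag(I, M⁻¹)` from the domain of the strain–momentum operator to
`dom B_{Y₁} × dom A`. -/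
def scale (A : X →ₗ.[ℂ] Y) (B : Y →ₗ.[ℂ] X) (M D : X →L[ℂ] X)
    (hM : IsBddUniformlyPositive M) :
    (strainMomentum A B M D hM).domain →ₗ[ℂ] (strainRestrict A B).domain × A.domain where
  toFun w := (⟨w.1.fst, w.2.1⟩, ⟨velocity M hM w.1.snd, w.2.2⟩)
  map_add' _ _ := Prod.ext rfl (Subtype.ext (map_add (velocity M hM) _ _))
  map_smul' _ _ := Prod.ext rfl (Subtype.ext (map_smul (velocity M hM) _ _))

variable [CompleteSpace G₁] [CompleteSpace G₂]

/-- The colligation with interior operator the strain–momentum operator, input map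
`½ ((1 - P) R Ξ₀ + (1 + P) Ξ₁) diag(I, M⁻¹)` and output map
`½ ((1 + P) R Ξ₀ + (1 - P) Ξ₁) diag(I, M⁻¹)`, where `R` is the Riesz isomorphism of `G₁ × G₂`. -/
def strainColligation (t : DualPairTriplet A B G₁ G₂) (M D : X →L[ℂ] X)
    (hM : IsBddUniformlyPositive M)
    (P : AntiDual (WithLp 2 (G₁ × G₂)) →L[ℂ] AntiDual (WithLp 2 (G₁ × G₂))) :
    Colligation (AntiDual (WithLp 2 (G₁ × G₂)))
      (WithLp 2 (StrainSpace A × MomentumSpace M hM))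
      (AntiDual (WithLp 2 (G₁ × G₂))) where
  dom := (strainMomentum A B M D hM).domain
  G := (1 / 2 : ℂ) •
    ((1 - P).toLinearMap ∘ₗ (riesz (WithLp 2 (G₁ × G₂))).toLinearEquiv.toLinearMap ∘ₗ t.Ξ₀ +
      (1 + P).toLinearMap ∘ₗ t.Ξ₁) ∘ₗ scale A B M D hM
  L := (strainMomentum A B M D hM).toFun
  K := (1 / 2 : ℂ) •
    ((1 + P).toLinearMap ∘ₗ (riesz (WithLp 2 (G₁ × G₂))).toLinearEquiv.toLinearMap ∘ₗ t.Ξ₀ +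
      (1 - P).toLinearMap ∘ₗ t.Ξ₁) ∘ₗ scale A B M D hM

end DualPairTriplet

end Setting

end BoundaryNode

end

/-! Set Γ₀ = R Ξ₀ diag(I, M⁻¹) and Γ₁ = Ξ₁ diag(I, M⁻¹), with R the Riesz map. Adding the Green
identity of the triplet to a conjugated copy of it gives a Green identity for L = `strainMomentum`,
up to the accretive damping term; its real part is 4 Re⟨z, L z⟩ ≤ ‖Γ₀z + Γ₁z‖² - ‖Γ₀z - Γ₁z‖². Input
and output are ½((Γ₀ + Γ₁) ∓ P(Γ₀ - Γ₁)). Hence the kernel of the input map is the condition Γ₀ + Γ₁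
= P(Γ₀ - Γ₁), on which L is dissipative because ‖P‖ ≤ 1. The Cayley transform with β = 1 has input
(Γ₀ + Γ₁)/√2 and output -P(Γ₀ - Γ₁)/√2, so the same inequality is scattering passivity.

What remains for Lumer–Phillips is that μ - L is onto under the boundary condition. For P = 0,
eliminating the strain y = μ⁻¹(f + A x) leaves a Lax–Milgram problem for x, with form ⟨ξ, (μM + D)x⟩
+ μ⁻¹⟨Aξ, Ax⟩ + ⟨Λξ, Λx⟩ (`exists_stationary`). For general P the boundary datum v = Γ₀z + Γ₁z is a
fixed point of v ↦ P(Γ₀z - Γ₁z). This map is a strict contraction even when ‖P‖ = 1, since Γ₀ and Γ₁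
are bounded in the graph norm (`exists_norm_le`, `exists_range_eq_of_norm_le_one`).

Passing from Y to ran A loses no boundary values: ran A is closed, and Π vanishes on its orthogonal
complement ker A*. The description of the energy space rests on dom A*A being a core of A: two
closed operators with the same A*A have the same form there, hence the same domain and norm. -/

noncomputable section

namespace BoundaryNode

/-! ### Generation of contraction semigroups -/

section Semigroup

variable {Z : Type*} [NormedAddCommGroup Z] [InnerProductSpace ℂ Z]

/-- Dissipative operators on a Hilbert space for which `μ - A` is onto for all `μ > 0`. -/
structure IsMaximalDissipative (A : Z →ₗ.[ℂ] Z) : Prop where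
  dissipative : ∀ z : A.domain, RCLike.re (inner ℂ (z : Z) (A z)) ≤ 0
  range : ∀ μ : ℝ, 0 < μ → ∀ f : Z, ∃ z : A.domain, (μ : ℂ) • (z : Z) - A z = f

theorem re_inner_ofReal_smul (μ : ℝ) (x y : Z) :
    RCLike.re (inner ℂ x ((μ : ℂ) • y)) = μ * RCLike.re (inner ℂ x y) := by
  rw [inner_smul_right]
  simp

theorem re_inner_self (x : Z) : RCLike.re (inner ℂ x x) = ‖x‖ ^ 2 :=
  (norm_sq_eq_re_inner (𝕜 := ℂ) x).symm

namespace IsMaximalDissipative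

variable {A : Z →ₗ.[ℂ] Z} (hA : IsMaximalDissipative A)
include hA

/-- Cauchy–Schwarz applied to Re⟨z, μz - Az⟩ ≥ μ‖z‖². This yields injectivity of μ - A and the
resolvent bound 1/μ. -/
theorem mul_norm_le {μ : ℝ} (z : A.domain) :
    μ * ‖(z : Z)‖ ≤ ‖(μ : ℂ) • (z : Z) - A z‖ := by
  have h1 : RCLike.re (inner ℂ (z : Z) ((μ : ℂ) • (z : Z) - A z)) =
      μ * ‖(z : Z)‖ ^ 2 - RCLike.re (inner ℂ (z : Z) (A z)) := by
    rw [inner_sub_right, map_sub, re_inner_ofReal_smul, re_inner_self]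
  have h2 := re_inner_le_norm (𝕜 := ℂ) (z : Z) ((μ : ℂ) • (z : Z) - A z)
  have h3 := hA.dissipative z
  rcases (norm_nonneg (z : Z)).eq_or_lt' with h0 | h0
  · rw [h0, mul_zero]; exact norm_nonneg _
  · refine le_of_mul_le_mul_left ?_ h0
    nlinarith

theorem exists_resolvent {μ : ℝ} (hμ : 0 < μ) :
    ∃ R : Z →L[ℂ] Z, (∀ x : Z, ∃ h : R x ∈ A.domain, (μ : ℂ) • R x - A ⟨R x, h⟩ = x) ∧
      (∀ z : A.domain, R ((μ : ℂ) • (z : Z) - A z) = z) ∧ ∀ x, μ * ‖R x‖ ≤ ‖x‖ := by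
  let T : A.domain →ₗ[ℂ] Z := (μ : ℂ) • A.domain.subtype - A.toFun
  have hT : ∀ z, T z = (μ : ℂ) • (z : Z) - A z := fun z => rfl
  have hinj : Function.Injective T := by
    rw [injective_iff_map_eq_zero]
    intro z hz
    have h := hA.mul_norm_le (μ := μ) z
    rw [← hT, hz, norm_zero] at h
    have : ‖(z : Z)‖ ≤ 0 := by
      by_contra h'
      have := mul_pos hμ (not_le.mp h')
      linarith
    exact Subtype.ext (norm_le_zero_iff.mp this)
  let e := LinearEquiv.ofBijective T ⟨hinj, fun f => hA.range μ hμ f⟩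
  have he : ∀ x, T (e.symm x) = x := fun x => e.apply_symm_apply x
  have hb : ∀ x, μ * ‖((e.symm x : A.domain) : Z)‖ ≤ ‖x‖ := fun x => by
    have h := hA.mul_norm_le (μ := μ) (e.symm x)
    rwa [← hT, he] at h
  refine ⟨(A.domain.subtype ∘ₗ e.symm.toLinearMap).mkContinuous μ⁻¹ fun x => ?_, fun x => ?_,
    fun z => ?_, fun x => hb x⟩
  · have := hb x
    rw [inv_mul_eq_div, le_div_iff₀ hμ, mul_comm]
    exact this
  · exact ⟨(e.symm x).2, he x⟩
  · exact congrArg Subtype.val (e.symm_apply_apply z)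

theorem mem_resolventSet {μ : ℝ} (hμ : 0 < μ) : (μ : ℂ) ∈ resolventSet A := by
  obtain ⟨R, h1, h2, -⟩ := hA.exists_resolvent hμ
  exact ⟨R, h1, h2⟩

/-- Write a vector v orthogonal to the domain as z - Az. Pairing with z gives ‖z‖² = Re⟨z, Az⟩ ≤ 0,
so z = 0 and v = 0. -/
theorem dense_domain [CompleteSpace Z] : Dense (A.domain : Set Z) := by
  rw [Submodule.dense_iff_topologicalClosure_eq_top, Submodule.topologicalClosure_eq_top_iff,
    Submodule.eq_bot_iff]
  intro v hv
  obtain ⟨z, hz⟩ := hA.range 1 one_pos v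
  have h1 := congrArg RCLike.re (Submodule.mem_orthogonal _ _ |>.mp hv z z.2)
  rw [← hz, inner_sub_right, map_sub, re_inner_ofReal_smul, re_inner_self] at h1
  have h2 := hA.dissipative z
  have h3 : ‖(z : Z)‖ ^ 2 ≤ 0 := by
    simp only [map_zero] at h1
    linarith
  have h4 : z = 0 := Subtype.ext (by simpa using h3)
  rw [← hz, h4, A.map_zero]
  simp

end IsMaximalDissipative

/-! #### Exponentials of bounded dissipative operators -/

section Exp

variable [CompleteSpace Z]

/-- The uniformly continuous semigroup generated by a bounded operator. -/
def expSemigroup (B : Z →L[ℂ] Z) (t : ℝ) : Z →L[ℂ] Z := NormedSpace.exp (t • B)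

theorem expSemigroup_zero (B : Z →L[ℂ] Z) : expSemigroup B 0 = 1 := by
  simp [expSemigroup]

theorem expSemigroup_add (B : Z →L[ℂ] Z) (s t : ℝ) :
    expSemigroup B (s + t) = expSemigroup B s * expSemigroup B t := by
  rw [expSemigroup, add_smul]
  let _ := NormedAlgebra.restrictScalars ℚ ℂ (Z →L[ℂ] Z)
  exact NormedSpace.exp_add_of_commute (((Commute.refl B).smul_left s).smul_right t)

theorem Commute.expSemigroup_right {B C : Z →L[ℂ] Z} (h : Commute C B) (t : ℝ) :
    Commute C (expSemigroup B t) :=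
  (h.smul_right t).exp_right

theorem hasDerivAt_expSemigroup_apply (B : Z →L[ℂ] Z) (x : Z) (t : ℝ) :
    HasDerivAt (fun s => expSemigroup B s x) (expSemigroup B t (B x)) t := by
  have h := hasDerivAt_exp_smul_const (𝕂 := ℝ) B t
  exact ((ContinuousLinearMap.apply ℂ Z x).restrictScalars ℝ).hasFDerivAt.comp_hasDerivAt t h

theorem norm_expSemigroup_apply_le {B : Z →L[ℂ] Z} (hB : ∀ x, RCLike.re (inner ℂ x (B x)) ≤ 0)
    {t : ℝ} (ht : 0 ≤ t) (x : Z) : ‖expSemigroup B t x‖ ≤ ‖x‖ := by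
  let _ : InnerProductSpace ℝ Z := InnerProductSpace.complexToReal
  have hd : ∀ s, HasDerivAt (fun s => ‖expSemigroup B s x‖ ^ 2)
      (2 * RCLike.re (inner ℂ (expSemigroup B s x) (B (expSemigroup B s x)))) s := fun s => by
    have h := (hasDerivAt_expSemigroup_apply B x s).norm_sq
    have hc : B (expSemigroup B s x) = expSemigroup B s (B x) :=
      congrArg (fun T : Z →L[ℂ] Z => T x)
        (Commute.expSemigroup_right (Commute.refl B) s).eq
    rw [hc]
    exact h
  have hanti : Antitone fun s => ‖expSemigroup B s x‖ ^ 2 :=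
    antitone_of_hasDerivAt_nonpos hd fun s => by
      have := hB (expSemigroup B s x)
      simp only [Pi.zero_apply]
      linarith
  have := hanti ht
  simp only [expSemigroup_zero, one_apply_eq_self] at this
  exact le_of_sq_le_sq this (norm_nonneg _)

/-- The path s ↦ e^{(t-s)C} e^{sB} x joins e^{tC} x to e^{tB} x. By commutation its derivative is
e^{(t-s)C} e^{sB} (B - C)x, and both exponentials are contractions. -/
theorem norm_expSemigroup_sub_le {B C : Z →L[ℂ] Z} (hBC : Commute B C)
    (hB : ∀ x, RCLike.re (inner ℂ x (B x)) ≤ 0) (hC : ∀ x, RCLike.re (inner ℂ x (C x)) ≤ 0)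
    {t : ℝ} (ht : 0 ≤ t) (x : Z) :
    ‖expSemigroup B t x - expSemigroup C t x‖ ≤ t * ‖B x - C x‖ := by
  have hd : ∀ s, HasDerivAt (fun s => expSemigroup C (t - s) (expSemigroup B s x))
      (expSemigroup C (t - s) (expSemigroup B s (B x - C x))) s := fun s => by
    have h1 : HasDerivAt (fun s => expSemigroup C (t - s)) (-(expSemigroup C (t - s) * C)) s := by
      have := HasDerivAt.scomp s (hasDerivAt_exp_smul_const (𝕂 := ℝ) C (t - s))
        ((hasDerivAt_id s).const_sub t)
      rw [neg_one_smul] at this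
      exact this
    have h2 : HasDerivAt (fun s => expSemigroup B s) (expSemigroup B s * B) s :=
      hasDerivAt_exp_smul_const (𝕂 := ℝ) B s
    have h3 := ((ContinuousLinearMap.apply ℂ Z x).restrictScalars ℝ).hasFDerivAt.comp_hasDerivAt s
      (h1.mul h2)
    have h4 : -(expSemigroup C (t - s) * C) * expSemigroup B s +
        expSemigroup C (t - s) * (expSemigroup B s * B) =
        expSemigroup C (t - s) * (expSemigroup B s * (B - C)) := by
      rw [neg_mul, mul_assoc, (Commute.expSemigroup_right hBC.symm s).eq]
      noncomm_ring
    rw [h4] at h3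
    exact h3
  have h := Convex.norm_image_sub_le_of_norm_hasDerivWithin_le (𝕜 := ℝ)
    (fun s _ => (hd s).hasDerivWithinAt) (C := ‖B x - C x‖) (s := Set.Icc 0 t)
    (fun s hs => (norm_expSemigroup_apply_le hC (by linarith [hs.2]) _).trans
      (norm_expSemigroup_apply_le hB hs.1 _)) (convex_Icc 0 t)
    (Set.left_mem_Icc.mpr ht) (Set.right_mem_Icc.mpr ht)
  simpa [expSemigroup_zero, abs_of_nonneg ht, mul_comm] using h

theorem norm_expSemigroup_sub_self_le {B : Z →L[ℂ] Z}
    (hB : ∀ x, RCLike.re (inner ℂ x (B x)) ≤ 0) {t : ℝ} (ht : 0 ≤ t) (x : Z) :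
    ‖expSemigroup B t x - x‖ ≤ t * ‖B x‖ := by
  have h := norm_expSemigroup_sub_le (Commute.zero_right B) hB (C := 0) (by simp) ht x
  simpa [expSemigroup] using h

/-- Mean value inequality for e^{sB} x - s v. It is the form of the difference quotient that
survives the limit in the Yosida approximations. -/
theorem norm_expSemigroup_sub_sub_smul_le {B : Z →L[ℂ] Z} {t K : ℝ} (ht : 0 ≤ t) (x v : Z)
    (hK : ∀ s ∈ Set.Icc 0 t, ‖expSemigroup B s (B x) - v‖ ≤ K) :
    ‖expSemigroup B t x - x - t • v‖ ≤ K * t := by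
  have h := Convex.norm_image_sub_le_of_norm_hasDerivWithin_le (𝕜 := ℝ)
    (f := fun s => expSemigroup B s x - s • v) (f' := fun s => expSemigroup B s (B x) - v)
    (fun s _ => ((hasDerivAt_expSemigroup_apply B x s).sub
      (by simpa using (hasDerivAt_id s).smul_const v)).hasDerivWithinAt) (C := K)
    (s := Set.Icc 0 t) hK (convex_Icc 0 t)
    (Set.left_mem_Icc.mpr ht) (Set.right_mem_Icc.mpr ht)
  simp only [expSemigroup_zero, zero_smul, sub_zero, Real.norm_eq_abs, abs_of_nonneg ht] at h
  convert h using 2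
  simp
  abel

end Exp

end Semigroup

/-! ### Yosida approximation and the Lumer–Phillips theorem. -/

section Semigroup

variable {Z : Type*} [NormedAddCommGroup Z] [InnerProductSpace ℂ Z] [CompleteSpace Z]

namespace IsMaximalDissipative

variable {A : Z →ₗ.[ℂ] Z} (hA : IsMaximalDissipative A)
include hA

theorem exists_norm_sub_lt (x : Z) {ε : ℝ} (hε : 0 < ε) :
    ∃ z : A.domain, ‖x - z‖ < ε := by
  obtain ⟨z, h, hz⟩ := Metric.dense_iff.mp hA.dense_domain x ε hε
  exact ⟨⟨z, hz⟩, by rw [← dist_eq_norm]; exact Metric.mem_ball'.mp h⟩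

/-- Existence of the Yosida approximations. -/
theorem exists_yosida :
    ∃ B : ℕ → Z →L[ℂ] Z, (∀ n x, RCLike.re (inner ℂ x (B n x)) ≤ 0) ∧
      (∀ m n, Commute (B m) (B n)) ∧ (∀ n, ∀ z : A.domain, ‖B n z‖ ≤ ‖A z‖) ∧
      ∀ z : A.domain, Tendsto (fun n => B n z) atTop (𝓝 (A z)) := by
  have hpos : ∀ n : ℕ, (0 : ℝ) < n + 1 := fun n => by positivity
  choose R hR1 hR2 hR3 using fun n : ℕ => hA.exists_resolvent (hpos n)
  have hRA : ∀ n : ℕ, ∀ z : A.domain, (((n : ℝ) + 1 : ℝ) : ℂ) • R n z - z = R n (A z) := fun n z => by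
    have h := hR2 n z
    rw [map_sub, map_smul] at h
    rw [sub_eq_iff_eq_add] at h
    rw [h, add_sub_cancel_left]
  have hJ : ∀ (n : ℕ) (x : Z), ‖(((n : ℝ) + 1 : ℝ) : ℂ) • R n x‖ ≤ ‖x‖ := fun n x => by
    rw [norm_smul, Complex.norm_real, Real.norm_of_nonneg (hpos n).le]
    exact hR3 n x
  -- By the resolvent identity, used in both orders.
  have hcomm : ∀ m n, Commute (R m) (R n) := fun m n => by
    rcases eq_or_ne m n with rfl | hmn
    · exact Commute.refl _
    have key : ∀ m n : ℕ, ∀ x, R m x =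
        ((((n : ℝ) + 1 : ℝ) : ℂ) - (((m : ℝ) + 1 : ℝ) : ℂ)) • R n (R m x) + R n x := by
      intro m n x
      obtain ⟨h, hx⟩ := hR1 m x
      have h2 := hR2 n ⟨R m x, h⟩
      have h3 : A ⟨R m x, h⟩ = (((m : ℝ) + 1 : ℝ) : ℂ) • R m x - x := by
        rw [eq_sub_iff_add_eq, ← eq_sub_iff_add_eq', hx]
      rw [h3] at h2
      refine h2.symm.trans ?_
      simp only [map_sub, map_smul]
      module
    ext x
    have h1 := key m n x
    have h2 := key n m x
    have h3 : ((((n : ℝ) + 1 : ℝ) : ℂ) - (((m : ℝ) + 1 : ℝ) : ℂ)) •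
        (R m (R n x) - R n (R m x)) = 0 := by
      linear_combination (norm := module) h1 + h2
    have h4 : ((((n : ℝ) + 1 : ℝ) : ℂ) - (((m : ℝ) + 1 : ℝ) : ℂ)) ≠ 0 := by
      rw [sub_ne_zero]
      intro h
      have : n = m := by simpa using h
      exact hmn this.symm
    exact sub_eq_zero.mp ((smul_eq_zero.mp h3).resolve_left h4)
  have hBz : ∀ n : ℕ, ∀ z : A.domain,
      (((n : ℝ) + 1 : ℝ) : ℂ) • ((((n : ℝ) + 1 : ℝ) : ℂ) • R n - 1) z =
        (((n : ℝ) + 1 : ℝ) : ℂ) • R n (A z) := fun n z => by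
    rw [← hRA]; rfl
  -- The approximation is λ(λR(λ) - 1) with λ = n + 1, positive also for n = 0. It is dissipative
  -- because λR(λ) is a contraction, and it equals λR(λ)A on dom A.
  refine ⟨fun n => (((n : ℝ) + 1 : ℝ) : ℂ) • ((((n : ℝ) + 1 : ℝ) : ℂ) • R n - 1), fun n x => ?_,
    fun m n => ?_, fun n z => ?_, fun z => ?_⟩
  · have h1 := re_inner_le_norm (𝕜 := ℂ) x ((((n : ℝ) + 1 : ℝ) : ℂ) • R n x)
    have h2 := mul_le_mul_of_nonneg_left (hJ n x) (norm_nonneg x)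
    have h3 : (((((n : ℝ) + 1 : ℝ) : ℂ) • ((((n : ℝ) + 1 : ℝ) : ℂ) • R n - 1) : Z →L[ℂ] Z)) x =
      (((n : ℝ) + 1 : ℝ) : ℂ) • ((((n : ℝ) + 1 : ℝ) : ℂ) • R n x - x) := rfl
    rw [h3, re_inner_ofReal_smul, inner_sub_right, map_sub, re_inner_self]
    refine mul_nonpos_of_nonneg_of_nonpos (hpos n).le ?_
    linarith [sq ‖x‖]
  · exact (((((hcomm m n).smul_left _).sub_left (Commute.one_left _)).smul_left _).smul_right
      _).sub_right (Commute.one_right _) |>.smul_right _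
  · exact (congrArg norm (hBz n z)).trans_le (hJ n _)
  · refine Tendsto.congr (fun n => (hBz n z).symm) ?_
    rw [Metric.tendsto_atTop]
    intro ε hε
    -- A z need not lie in dom A. For w in dom A, λR(λ)w - w = R(λ)Aw has norm at most ‖Aw‖/λ;
    -- contractivity of λR(λ) controls the rest.
    obtain ⟨w, hw⟩ := hA.exists_norm_sub_lt (A z) (ε := ε / 4) (by positivity)
    obtain ⟨N, hN⟩ := exists_nat_gt (2 * ‖A w‖ / ε)
    refine ⟨N, fun n hn => ?_⟩
    rw [dist_eq_norm]
    have e : (((n : ℝ) + 1 : ℝ) : ℂ) • R n (A z) - A z =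
        (((n : ℝ) + 1 : ℝ) : ℂ) • R n (A z - w) + R n (A w) - (A z - w) := by
      rw [← hRA n w, map_sub]
      module
    have h1 := hJ n (A z - w)
    have h2 := hR3 n (A w)
    have h3 : ‖R n (A w)‖ < ε / 2 := by
      have h4 : 2 * ‖A w‖ / ε < n + 1 :=
        hN.trans_le ((Nat.cast_le.mpr hn).trans (by linarith))
      rw [div_lt_iff₀ hε] at h4
      have h5 := hpos n
      by_contra h6
      have := mul_le_mul_of_nonneg_left (not_lt.mp h6) h5.le
      linarith
    rw [e]
    refine (norm_sub_le _ _).trans_lt ?_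
    have h7 := norm_add_le ((((n : ℝ) + 1 : ℝ) : ℂ) • R n (A z - w)) (R n (A w))
    linarith

/-- The Lumer–Phillips theorem in a Hilbert space. -/
theorem exists_isGenerator : ∃ T : C0Semigroup Z, T.IsGenerator A := by
  obtain ⟨B, hB, hcomm, hBA, hlim⟩ := hA.exists_yosida
  have hcauchy : ∀ (t : ℝ≥0) (x : Z), ∃ y,
      Tendsto (fun n => expSemigroup (B n) t x) atTop (𝓝 y) := by
    intro t x
    refine cauchySeq_tendsto_of_complete (Metric.cauchySeq_iff.mpr fun ε hε => ?_)
    obtain ⟨z, hz⟩ := hA.exists_norm_sub_lt x (ε := ε / 4) (by positivity)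
    obtain ⟨N, hN⟩ := Metric.cauchySeq_iff.mp (hlim z).cauchySeq (ε / (2 * (t + 1)))
      (by positivity)
    refine ⟨N, fun m hm n hn => ?_⟩
    have h1 := hN m hm n hn
    rw [dist_eq_norm] at h1 ⊢
    have h2 := norm_expSemigroup_sub_le (hcomm m n) (hB m) (hB n) t.2 (z : Z)
    have h3 := norm_expSemigroup_apply_le (hB m) t.2 (x - z)
    have h4 := norm_expSemigroup_apply_le (hB n) t.2 (x - z)
    have h5 : (t : ℝ) * ‖B m z - B n z‖ ≤ ε / 2 := by
      calc (t : ℝ) * ‖B m z - B n z‖ ≤ (t + 1) * (ε / (2 * (t + 1))) := by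
            gcongr
            linarith
        _ = ε / 2 := by field_simp
    have e : expSemigroup (B m) t x - expSemigroup (B n) t x =
        expSemigroup (B m) t (x - z) + (expSemigroup (B m) t z - expSemigroup (B n) t z) -
          expSemigroup (B n) t (x - z) := by
      simp only [map_sub]
      abel
    rw [e]
    refine (norm_sub_le _ _).trans_lt ?_
    have h6 := norm_add_le (expSemigroup (B m) t (x - z))
      (expSemigroup (B m) t z - expSemigroup (B n) t z)
    simp only [NNReal.val_eq_coe] at h2 h3 h4
    linarith
  choose S hS using hcauchy
  have hSn : ∀ t x, ‖S t x‖ ≤ ‖x‖ := fun t x =>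
    le_of_tendsto (hS t x).norm
      (Eventually.of_forall fun n => norm_expSemigroup_apply_le (hB n) t.2 x)
  let T : ℝ≥0 → Z →L[ℂ] Z := fun t =>
    LinearMap.mkContinuous
      { toFun := S t
        map_add' := fun x y => tendsto_nhds_unique (hS t (x + y)) (by
          simpa only [map_add] using (hS t x).add (hS t y))
        map_smul' := fun c x => tendsto_nhds_unique (hS t (c • x)) (by
          simpa only [map_smul, RingHom.id_apply] using (hS t x).const_smul c) } 1
      fun x => by simpa using hSn t x
  have hT : ∀ (t : ℝ≥0) (x : Z), Tendsto (fun n => expSemigroup (B n) t x) atTop (𝓝 (T t x)) := hS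
  have hTn : ∀ t x, ‖T t x‖ ≤ ‖x‖ := hSn
  have hzero : T 0 = ContinuousLinearMap.id ℂ Z := by
    ext x
    exact tendsto_nhds_unique (hT 0 x) (by simp [expSemigroup_zero])
  have hadd : ∀ s t, T (s + t) = (T s).comp (T t) := by
    intro s t
    ext x
    refine tendsto_nhds_unique (hT (s + t) x) ?_
    have h1 : Tendsto (fun n => expSemigroup (B n) s (expSemigroup (B n) t x - T t x))
        atTop (𝓝 0) := by
      refine squeeze_zero_norm (fun n => norm_expSemigroup_apply_le (hB n) s.2 _) ?_
      simpa using ((hT t x).sub_const (T t x)).norm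
    have h2 := h1.add (hT s (T t x))
    rw [zero_add] at h2
    refine h2.congr fun n => ?_
    rw [map_sub, sub_add_cancel, NNReal.coe_add, expSemigroup_add]
    rfl
  have hlip : ∀ t, ∀ z : A.domain, ‖T t z - z‖ ≤ t * ‖A z‖ := fun t z =>
    le_of_tendsto ((hT t z).sub_const _).norm (Eventually.of_forall fun n =>
      (norm_expSemigroup_sub_self_le (hB n) t.2 _).trans
        (mul_le_mul_of_nonneg_left (hBA n z) t.2))
  have hlip' : ∀ s t, ∀ z : A.domain, ‖T s z - T t z‖ ≤ dist s t * ‖A z‖ := by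
    have key : ∀ s t : ℝ≥0, s ≤ t → ∀ z : A.domain, ‖T s z - T t z‖ ≤ dist s t * ‖A z‖ := by
      intro s t hst z
      have h1 : T t z = T s (T (t - s) z) := by
        rw [← ContinuousLinearMap.comp_apply, ← hadd, add_tsub_cancel_of_le hst]
      rw [h1, ← map_sub, NNReal.dist_eq, abs_sub_comm, abs_of_nonneg (sub_nonneg.mpr
        (NNReal.coe_le_coe.mpr hst)), ← NNReal.coe_sub hst]
      refine (hTn s _).trans ?_
      rw [norm_sub_rev]
      exact hlip (t - s) z
    intro s t z
    rcases le_total s t with h | h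
    · exact key s t h z
    · rw [norm_sub_rev, dist_comm]; exact key t s h z
  have hcont : ∀ x, Continuous fun t => T t x := by
    intro x
    -- Orbits of vectors in the domain are Lipschitz; contractivity makes every orbit a uniform
    -- limit of these.
    refine continuous_of_uniform_approx_of_continuous fun u hu => ?_
    obtain ⟨ε, hε, hεu⟩ := Metric.mem_uniformity_dist.mp hu
    obtain ⟨z, hz⟩ := hA.exists_norm_sub_lt x hε
    refine ⟨fun t => T t z, ?_, fun t => hεu ?_⟩
    · refine (LipschitzWith.of_dist_le_mul (K := ‖A z‖₊) fun s t => ?_).continuous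
      rw [dist_eq_norm, mul_comm]
      exact hlip' s t z
    · rw [dist_eq_norm, ← map_sub]
      exact (hTn t _).trans_lt hz
  have hgen : ∀ z : A.domain, Tendsto (fun t : ℝ≥0 => ((t : ℝ) : ℂ)⁻¹ • (T t z - z))
      (𝓝[>] 0) (𝓝 (A z)) := by
    intro z
    -- The vector w in dom A stands in for A z, so that z need not be in dom A²; the bound passes to
    -- the limit in n.
    have hest : ∀ t : ℝ≥0, ∀ w : A.domain,
        ‖T t z - z - (t : ℝ) • A z‖ ≤ (2 * ‖A z - w‖ + t * ‖A w‖) * t := by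
      intro t w
      have h1 : ∀ n, ‖expSemigroup (B n) t z - z - (t : ℝ) • A z‖ ≤
          (‖B n z - A z‖ + 2 * ‖A z - w‖ + t * ‖A w‖) * t := fun n => by
        refine norm_expSemigroup_sub_sub_smul_le t.2 _ _ fun s hs => ?_
        have e : expSemigroup (B n) s (B n z) - A z =
            expSemigroup (B n) s (B n z - A z) + expSemigroup (B n) s (A z - w) +
              (expSemigroup (B n) s w - w) - (A z - w) := by
          simp only [map_sub]
          abel
        rw [e]
        have h2 := norm_expSemigroup_apply_le (hB n) hs.1 (B n z - A z)
        have h3 := norm_expSemigroup_apply_le (hB n) hs.1 (A z - w)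
        have h4 := norm_expSemigroup_sub_self_le (hB n) hs.1 (w : Z)
        have h5 : s * ‖B n w‖ ≤ t * ‖A w‖ :=
          mul_le_mul hs.2 (hBA n w) (norm_nonneg _) t.2
        refine (norm_sub_le _ _).trans ?_
        have h6 := norm_add₃_le (a := expSemigroup (B n) s (B n z - A z))
          (b := expSemigroup (B n) s (A z - w)) (c := expSemigroup (B n) s w - w)
        linarith
      refine le_of_tendsto_of_tendsto (((hT t z).sub_const _).sub_const _).norm
        (f := fun n => ‖expSemigroup (B n) t z - z - (t : ℝ) • A z‖)
        (g := fun n => (‖B n z - A z‖ + 2 * ‖A z - w‖ + t * ‖A w‖) * t) ?_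
        (Eventually.of_forall h1)
      have h7 : Tendsto (fun n => ‖B n z - A z‖) atTop (𝓝 0) := by
        simpa using ((hlim z).sub_const (A z)).norm
      simpa using ((h7.add_const (2 * ‖A z - w‖)).add_const (t * ‖A w‖)).mul_const (t : ℝ)
    rw [Metric.tendsto_nhdsWithin_nhds]
    intro ε hε
    obtain ⟨w, hw⟩ := hA.exists_norm_sub_lt (A z) (ε := ε / 4) (by positivity)
    refine ⟨ε / (2 * (‖A w‖ + 1)), by positivity, fun t ht htd => ?_⟩
    have ht' : (0 : ℝ) < t := ht
    rw [NNReal.dist_eq, NNReal.coe_zero, sub_zero, abs_of_pos ht',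
      lt_div_iff₀ (by positivity)] at htd
    have e : ((t : ℝ) : ℂ)⁻¹ • (T t z - z) - A z =
        ((t : ℝ) : ℂ)⁻¹ • (T t z - z - (t : ℝ) • A z) := by
      have h0 : ((t : ℝ) : ℂ) ≠ 0 := by exact_mod_cast ht'.ne'
      rw [smul_sub _ _ ((t : ℝ) • A z), ← Complex.coe_smul, inv_smul_smul₀ h0]
    rw [dist_eq_norm, e, norm_smul, norm_inv, Complex.norm_real, Real.norm_of_nonneg ht'.le,
      inv_mul_lt_iff₀ ht']
    refine (hest t w).trans_lt ?_
    rw [mul_comm]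
    refine mul_lt_mul_of_pos_left ?_ ht'
    nlinarith [norm_nonneg (A w)]
  refine ⟨⟨T, hzero, hadd, hcont⟩, fun x y => ⟨fun h => ?_, fun h => ?_⟩⟩
  · obtain ⟨z, rfl, rfl⟩ := A.mem_graph_iff.mp h
    exact hgen z
  -- No proper extension is possible. With z - Az = x - y, the orbit of x - z has right derivative y
  -- - Az = x - z at 0, and contractivity forces Re⟨x - z, x - z⟩ ≤ 0.
  · obtain ⟨z, hz⟩ := hA.range 1 one_pos (x - y)
    have h1 : Tendsto (fun t : ℝ≥0 => RCLike.re (inner ℂ (x - z)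
        (((t : ℝ) : ℂ)⁻¹ • (T t (x - z) - (x - z))))) (𝓝[>] 0)
        (𝓝 (RCLike.re (inner ℂ (x - z) (y - A z)))) := by
      have h2 : Tendsto (fun t : ℝ≥0 => ((t : ℝ) : ℂ)⁻¹ • (T t (x - z) - (x - z))) (𝓝[>] 0)
          (𝓝 (y - A z)) := by
        refine (h.sub (hgen z)).congr fun t => ?_
        change ((t : ℝ) : ℂ)⁻¹ • (T t x - x) - ((t : ℝ) : ℂ)⁻¹ • (T t z - z) = _
        rw [map_sub]
        module
      exact (RCLike.continuous_re.tendsto _).comp (tendsto_const_nhds.inner h2)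
    have h3 : y - A z = x - z := by
      have : (z : Z) - A z = x - y := by simpa using hz
      rw [sub_eq_sub_iff_add_eq_add] at this ⊢
      rw [add_comm, ← this, add_comm]
    rw [h3, re_inner_self] at h1
    have h4 : ‖x - z‖ ^ 2 ≤ 0 := by
      refine le_of_tendsto h1 (Eventually.of_forall fun t => ?_)
      have h5 := re_inner_le_norm (𝕜 := ℂ) (x - z) (T t (x - z))
      have h6 := mul_le_mul_of_nonneg_left (hTn t (x - z)) (norm_nonneg (x - z))
      rw [← Complex.ofReal_inv, re_inner_ofReal_smul, inner_sub_right, map_sub, re_inner_self]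
      refine mul_nonpos_of_nonneg_of_nonpos (inv_nonneg.mpr t.2) ?_
      nlinarith
    have h7 : x = z := by
      have : ‖x - z‖ = 0 := by nlinarith [norm_nonneg (x - z)]
      exact sub_eq_zero.mp (norm_eq_zero.mp this)
    have h8 : y = A z := by
      rw [← sub_eq_zero, h3, h7, sub_self]
    rw [h7, h8]
    exact A.mem_graph z

end IsMaximalDissipative

end Semigroup

/-! ### Boundary triplets of dissipative operators -/

section Triplet

variable {Z U V : Type*} [NormedAddCommGroup Z] [InnerProductSpace ℂ Z] [CompleteSpace Z]
  [NormedAddCommGroup U] [InnerProductSpace ℂ U] [CompleteSpace U]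
  [NormedAddCommGroup V] [InnerProductSpace ℂ V] [CompleteSpace V]

theorem _root_.LinearPMap.IsClosed.exists_of_tendsto {E F : Type*} [NormedAddCommGroup E]
    [InnerProductSpace ℂ E] [NormedAddCommGroup F] [InnerProductSpace ℂ F] {T : E →ₗ.[ℂ] F}
    (hT : T.IsClosed) {z : ℕ → T.domain} {a : E} {b : F}
    (ha : Tendsto (fun n => (z n : E)) atTop (𝓝 a)) (hb : Tendsto (fun n => T (z n)) atTop (𝓝 b)) :
    ∃ w : T.domain, (w : E) = a ∧ T w = b := by
  have h : (a, b) ∈ (T.graph : Set (E × F)) :=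
    IsClosed.mem_of_tendsto hT (ha.prodMk_nhds hb) (Eventually.of_forall fun n => T.mem_graph (z n))
  exact T.mem_graph_iff.mp h

theorem _root_.LinearPMap.isClosed_of_forall_tendsto {E F : Type*} [NormedAddCommGroup E]
    [InnerProductSpace ℂ E] [NormedAddCommGroup F] [NormedSpace ℂ F] {T : E →ₗ.[ℂ] F}
    (h : ∀ (z : ℕ → T.domain) (a : E) (b : F), Tendsto (fun n => (z n : E)) atTop (𝓝 a) →
      Tendsto (fun n => T (z n)) atTop (𝓝 b) → ∃ w : T.domain, (w : E) = a ∧ T w = b) :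
    T.IsClosed := by
  refine IsSeqClosed.isClosed fun p q hp hq => ?_
  choose z hz1 hz2 using fun n => T.mem_graph_iff.mp (hp n)
  refine T.mem_graph_iff.mpr (h z q.1 q.2 ?_ ?_)
  · simp only [hz1]; exact (continuous_fst.tendsto q).comp hq
  · simp only [hz2]; exact (continuous_snd.tendsto q).comp hq

/-- A pair of boundary maps for a closed operator `L`, jointly surjective and satisfying an
abstract Green identity up to the bounded accretive part of `-L`, such that `L` restricted to
`ker (Γ₀ + Γ₁)` has the positive half-line in its resolvent set. -/
structure IsDissipativeTriplet (L : Z →ₗ.[ℂ] Z) (Γ₀ Γ₁ : L.domain →ₗ[ℂ] U) : Prop where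
  closed : L.IsClosed
  surjective : ∀ a b, ∃ z, Γ₀ z = a ∧ Γ₁ z = b
  green : ∃ C : Z →L[ℂ] Z, (∀ z, 0 ≤ RCLike.re (inner ℂ z (C z))) ∧ ∀ z z' : L.domain,
    inner ℂ (Γ₁ z) (Γ₀ z') + inner ℂ (Γ₀ z) (Γ₁ z') =
      inner ℂ (L z) (z' : Z) + inner ℂ (z : Z) (L z') +
        (inner ℂ (C z) (z' : Z) + inner ℂ (z : Z) (C z'))
  range : ∀ μ : ℝ, 0 < μ → ∀ f : Z, ∃ z : L.domain, (μ : ℂ) • (z : Z) - L z = f ∧ Γ₀ z + Γ₁ z = 0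

namespace IsDissipativeTriplet

variable {L : Z →ₗ.[ℂ] Z} {Γ₀ Γ₁ : L.domain →ₗ[ℂ] U} (h : IsDissipativeTriplet L Γ₀ Γ₁)
include h

omit [CompleteSpace Z] [CompleteSpace U] in
-- Polarisation of 4 Re⟨Γ₀z, Γ₁z⟩ in the diagonal Green identity; the damping contribution has a
-- sign and is dropped.
theorem four_mul_re_inner_le (z : L.domain) :
    4 * RCLike.re (inner ℂ (z : Z) (L z)) ≤ ‖Γ₀ z + Γ₁ z‖ ^ 2 - ‖Γ₀ z - Γ₁ z‖ ^ 2 := by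
  obtain ⟨C, hC, hg⟩ := h.green
  have h1 := congrArg RCLike.re (hg z z)
  simp only [map_add] at h1
  rw [inner_re_symm (Γ₁ z), inner_re_symm (L z), inner_re_symm (C z)] at h1
  rw [norm_add_sq (𝕜 := ℂ), norm_sub_sq (𝕜 := ℂ)]
  have := hC z
  linarith

/-- Closed graph theorem on the graph of L. The Green identity passes to the limit against any test
element, and joint surjectivity leaves only one possible limit of the boundary values. -/
theorem exists_norm_le : ∃ c : ℝ, 0 < c ∧ ∀ z : L.domain,
    ‖Γ₀ z‖ ≤ c * (‖(z : Z)‖ + ‖L z‖) ∧ ‖Γ₁ z‖ ≤ c * (‖(z : Z)‖ + ‖L z‖) := by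
  obtain ⟨C, hC, hg⟩ := h.green
  have : CompleteSpace L.graph := h.closed.completeSpace_coe
  let π : L.graph →ₗ[ℂ] L.domain := LinearMap.codRestrict L.domain
    (LinearMap.fst ℂ Z Z ∘ₗ L.graph.subtype) fun p => LinearPMap.mem_domain_of_mem_graph p.2
  have hπ : ∀ p : L.graph, L (π p) = p.1.2 := fun p => ((L.image_iff (π p).2).mpr p.2).symm
  have hcont := ((Γ₀.prod Γ₁) ∘ₗ π).continuous_of_seq_closed_graph (by
    intro u p q hu hq
    have h1 : Tendsto (fun n => (π (u n) : Z)) atTop (𝓝 (π p : Z)) :=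
      ((continuous_fst.comp continuous_subtype_val).tendsto p).comp hu
    have h2 : Tendsto (fun n => L (π (u n))) atTop (𝓝 (L (π p))) := by
      simp only [hπ]
      exact ((continuous_snd.comp continuous_subtype_val).tendsto p).comp hu
    have h3 : Tendsto (fun n => Γ₀ (π (u n))) atTop (𝓝 q.1) := (continuous_fst.tendsto q).comp hq
    have h4 : Tendsto (fun n => Γ₁ (π (u n))) atTop (𝓝 q.2) := (continuous_snd.tendsto q).comp hq
    have h5 : ∀ w, inner ℂ q.2 (Γ₀ w) + inner ℂ q.1 (Γ₁ w) =
        inner ℂ (Γ₁ (π p)) (Γ₀ w) + inner ℂ (Γ₀ (π p)) (Γ₁ w) := by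
      intro w
      refine tendsto_nhds_unique ((h4.inner tendsto_const_nhds).add (h3.inner tendsto_const_nhds)) ?_
      simp only [hg]
      exact ((h2.inner tendsto_const_nhds).add (h1.inner tendsto_const_nhds)).add
        ((((C.continuous.tendsto _).comp h1).inner tendsto_const_nhds).add
          (h1.inner tendsto_const_nhds))
    -- The components are swapped so that the Green pairing becomes a sum of two squared norms.
    obtain ⟨w, hw0, hw1⟩ := h.surjective (q.2 - Γ₁ (π p)) (q.1 - Γ₀ (π p))
    have h6 := h5 w
    have h7 : inner ℂ (q.2 - Γ₁ (π p)) (Γ₀ w) + inner ℂ (q.1 - Γ₀ (π p)) (Γ₁ w) = 0 := by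
      rw [inner_sub_left, inner_sub_left]
      linear_combination h6
    rw [hw0, hw1] at h7
    have h8 := congrArg RCLike.re h7
    rw [map_add, re_inner_self, re_inner_self, map_zero] at h8
    have h9 : q.2 - Γ₁ (π p) = 0 := by
      rw [← norm_eq_zero, ← sq_eq_zero_iff]
      linarith [sq_nonneg ‖q.1 - Γ₀ (π p)‖, sq_nonneg ‖q.2 - Γ₁ (π p)‖]
    have h10 : q.1 - Γ₀ (π p) = 0 := by
      rw [← norm_eq_zero, ← sq_eq_zero_iff]
      linarith [sq_nonneg ‖q.1 - Γ₀ (π p)‖, sq_nonneg ‖q.2 - Γ₁ (π p)‖]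
    exact Prod.ext (sub_eq_zero.mp h10) (sub_eq_zero.mp h9))
  obtain ⟨c, hc, hb⟩ := (⟨_, hcont⟩ : L.graph →L[ℂ] U × U).bound
  refine ⟨c, hc, fun z => ?_⟩
  have h1 := hb ⟨((z : Z), L z), L.mem_graph z⟩
  have h2 : ‖(Γ₀ z, Γ₁ z)‖ ≤ c * ‖((z : Z), L z)‖ := h1
  have h3 : ‖((z : Z), L z)‖ ≤ ‖(z : Z)‖ + ‖L z‖ :=
    max_le (le_add_of_nonneg_right (norm_nonneg _)) (le_add_of_nonneg_left (norm_nonneg _))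
  have h4 := h2.trans (mul_le_mul_of_nonneg_left h3 hc.le)
  exact ⟨(norm_fst_le (Γ₀ z, Γ₁ z)).trans h4, (norm_snd_le (Γ₀ z, Γ₁ z)).trans h4⟩

omit [CompleteSpace Z] [CompleteSpace U] in
theorem exists_range_eq {μ : ℝ} (hμ : 0 < μ) (f : Z) (v : U) :
    ∃ z : L.domain, (μ : ℂ) • (z : Z) - L z = f ∧ Γ₀ z + Γ₁ z = v := by
  obtain ⟨z', h0, h1⟩ := h.surjective v 0
  obtain ⟨z, hz, hz'⟩ := h.range μ hμ (f - ((μ : ℂ) • (z' : Z) - L z'))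
  refine ⟨z + z', ?_, ?_⟩
  · rw [L.map_add, Submodule.coe_add, smul_add, add_sub_add_comm, hz, sub_add_cancel]
  · rw [map_add, map_add, add_add_add_comm, hz', h0, h1, add_zero, zero_add]

/-- Solvability of the resolvent equation under the boundary condition
`Γ₀ z + Γ₁ z = Q (Γ₀ z - Γ₁ z)`: the transfer function is a strict contraction. -/
theorem exists_range_eq_of_norm_le_one {Q : U →L[ℂ] U} (hQ : ‖Q‖ ≤ 1) {μ : ℝ} (hμ : 0 < μ) (f : Z) :
    ∃ z : L.domain, (μ : ℂ) • (z : Z) - L z = f ∧ Γ₀ z + Γ₁ z = Q (Γ₀ z - Γ₁ z) := by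
  obtain ⟨c, hc, hb⟩ := h.exists_norm_le
  -- `S` is only a choice of solutions; linearity is not needed, since differences solve the
  -- homogeneous equation L z = μ z.
  choose S hS1 hS2 using fun v => h.exists_range_eq hμ f v
  -- If L z = μ z and v = Γ₀z + Γ₁z, then ‖v‖ ≤ 2c(1 + μ)‖z‖, so the dissipation 4μ‖z‖² is at least
  -- δ‖v‖². Hence ‖Γ₀z - Γ₁z‖² ≤ (1 - δ)‖v‖².
  set δ : ℝ := μ / (c * (1 + μ)) ^ 2 with hδ
  have hδ0 : 0 < δ := by positivity
  have key : ∀ v v', ‖Q (Γ₀ (S v) - Γ₁ (S v)) - Q (Γ₀ (S v') - Γ₁ (S v'))‖ ≤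
      Real.sqrt (1 - δ) * ‖v - v'‖ := by
    intro v v'
    have hz : L (S v - S v') = (μ : ℂ) • ((S v - S v' : L.domain) : Z) := by
      rw [L.map_sub, Submodule.coe_sub, smul_sub]
      linear_combination (norm := module) (hS1 v').trans (hS1 v).symm
    have hv : Γ₀ (S v - S v') + Γ₁ (S v - S v') = v - v' := by
      conv_rhs => rw [← hS2 v, ← hS2 v']
      simp only [map_sub]
      abel
    have h1 := h.four_mul_re_inner_le (S v - S v')
    have h2 := hb (S v - S v')
    rw [hz, re_inner_ofReal_smul, re_inner_self, hv] at h1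
    rw [hz, norm_smul, Complex.norm_real, Real.norm_of_nonneg hμ.le] at h2
    set n := ‖((S v - S v' : L.domain) : Z)‖
    have h3 : ‖v - v'‖ ≤ 2 * (c * (1 + μ)) * n := by
      rw [← hv]
      refine (norm_add_le _ _).trans ?_
      linarith [h2.1, h2.2]
    have h4 : δ * ‖v - v'‖ ^ 2 ≤ 4 * (μ * n ^ 2) := by
      rw [hδ, div_mul_eq_mul_div, div_le_iff₀ (by positivity)]
      have h5 := pow_le_pow_left₀ (norm_nonneg _) h3 2
      nlinarith
    have h5 : ‖Γ₀ (S v - S v') - Γ₁ (S v - S v')‖ ^ 2 ≤ (1 - δ) * ‖v - v'‖ ^ 2 := by linarith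
    have e : Q (Γ₀ (S v) - Γ₁ (S v)) - Q (Γ₀ (S v') - Γ₁ (S v')) =
        Q (Γ₀ (S v - S v') - Γ₁ (S v - S v')) := by
      simp only [map_sub]
      abel
    rw [e]
    refine (Q.le_of_opNorm_le hQ _).trans ?_
    rw [one_mul]
    have h6 := Real.sqrt_le_sqrt h5
    rwa [Real.sqrt_mul' _ (sq_nonneg _), Real.sqrt_sq (norm_nonneg _),
      Real.sqrt_sq (norm_nonneg _)] at h6
  have hcontr : ContractingWith (Real.toNNReal (Real.sqrt (1 - δ)))
      fun v => Q (Γ₀ (S v) - Γ₁ (S v)) := by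
    constructor
    · rw [← NNReal.coe_lt_coe, Real.coe_toNNReal _ (Real.sqrt_nonneg _), NNReal.coe_one,
        Real.sqrt_lt' one_pos]
      linarith
    · refine LipschitzWith.of_dist_le_mul fun v v' => ?_
      rw [dist_eq_norm, dist_eq_norm, Real.coe_toNNReal _ (Real.sqrt_nonneg _)]
      exact key v v'
  refine ⟨S hcontr.fixedPoint, hS1 _, ?_⟩
  rw [hS2]
  exact hcontr.fixedPoint_isFixedPt.symm

omit [CompleteSpace V] in
theorem tendsto_apply {F : L.domain →ₗ[ℂ] V} {c : ℝ} (hF : ∀ z, ‖F z‖ ≤ c * (‖Γ₀ z‖ + ‖Γ₁ z‖))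
    {z : ℕ → L.domain} {w : L.domain} (h1 : Tendsto (fun n => (z n : Z)) atTop (𝓝 w))
    (h2 : Tendsto (fun n => L (z n)) atTop (𝓝 (L w))) :
    Tendsto (fun n => F (z n)) atTop (𝓝 (F w)) := by
  obtain ⟨b, hb, hΓ⟩ := h.exists_norm_le
  rw [tendsto_iff_norm_sub_tendsto_zero] at h1 h2 ⊢
  refine squeeze_zero (fun _ => norm_nonneg _) (fun n => ?_)
    (g := fun n => |c| * (2 * b * (‖(z n : Z) - w‖ + ‖L (z n) - L w‖)))
    (by simpa using ((h1.add h2).const_mul (2 * b)).const_mul |c|)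
  rw [← map_sub, ← L.map_sub, ← Submodule.coe_sub]
  refine (hF _).trans ((mul_le_mul_of_nonneg_right (le_abs_self c) (by positivity)).trans
    (mul_le_mul_of_nonneg_left ?_ (abs_nonneg c)))
  linarith [(hΓ (z n - w)).1, (hΓ (z n - w)).2]

/-- Colligations with interior operator `L`, graph-bounded boundary maps and main operator given by
a contractive boundary condition. -/
theorem isInternallyWellPosed {Q : U →L[ℂ] U} (hQ : ‖Q‖ ≤ 1) {G : L.domain →ₗ[ℂ] U}
    {K : L.domain →ₗ[ℂ] V} {c : ℝ} (hGc : ∀ z, ‖G z‖ ≤ c * (‖Γ₀ z‖ + ‖Γ₁ z‖))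
    (hKc : ∀ z, ‖K z‖ ≤ c * (‖Γ₀ z‖ + ‖Γ₁ z‖)) (hG : Function.Surjective G)
    (hker : ∀ z, G z = 0 ↔ Γ₀ z + Γ₁ z = Q (Γ₀ z - Γ₁ z)) :
    (⟨L.domain, G, L.toFun, K⟩ : Colligation U Z V).IsInternallyWellPosed := by
  set Θ : Colligation U Z V := ⟨L.domain, G, L.toFun, K⟩ with hΘ
  have hmem : ∀ z : Z, z ∈ Θ.mainOperator.domain ↔ ∃ hz : z ∈ L.domain, G ⟨z, hz⟩ = 0 := by
    intro z
    constructor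
    · rintro ⟨⟨w, hw, rfl⟩, -⟩
      exact ⟨w.2, hw⟩
    · rintro ⟨hz, hw⟩
      exact ⟨⟨⟨z, hz⟩, hw, rfl⟩, hz⟩
  have hmax : IsMaximalDissipative Θ.mainOperator := by
    constructor
    · intro z
      obtain ⟨hz, hw⟩ := (hmem z).mp z.2
      have h1 := h.four_mul_re_inner_le ⟨z, hz⟩
      rw [(hker _).mp hw] at h1
      have h2 := pow_le_pow_left₀ (norm_nonneg _)
        (Q.le_of_opNorm_le hQ (Γ₀ ⟨z, hz⟩ - Γ₁ ⟨z, hz⟩)) 2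
      rw [one_mul] at h2
      have h3 : Θ.mainOperator z = L ⟨z, hz⟩ := rfl
      rw [h3]
      linarith
    · intro μ hμ f
      obtain ⟨z, hz, hz'⟩ := h.exists_range_eq_of_norm_le_one hQ hμ f
      exact ⟨⟨z, (hmem z).mpr ⟨z.2, (hker z).mpr hz'⟩⟩, hz⟩
  refine ⟨⟨inferInstance, inferInstance, inferInstance, ?_, hG, ?_,
    ⟨_, hmax.mem_resolventSet one_pos⟩⟩,
    hmax.exists_isGenerator⟩
  · refine LinearPMap.isClosed_of_forall_tendsto fun z a p ha hp => ?_
    have h1 : Tendsto (fun n => G (z n)) atTop (𝓝 p.1) := (continuous_fst.tendsto p).comp hp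
    have h2 : Tendsto (fun n => L (z n)) atTop (𝓝 p.2.1) :=
      (((continuous_fst.comp continuous_snd).tendsto p).comp hp)
    have h3 : Tendsto (fun n => K (z n)) atTop (𝓝 p.2.2) :=
      (((continuous_snd.comp continuous_snd).tendsto p).comp hp)
    obtain ⟨w, rfl, hw⟩ := h.closed.exists_of_tendsto ha h2
    rw [← hw] at h2
    refine ⟨w, rfl, Prod.ext ?_ (Prod.ext hw ?_)⟩
    · exact tendsto_nhds_unique (h.tendsto_apply hGc ha h2) h1
    · exact tendsto_nhds_unique (h.tendsto_apply hKc ha h2) h3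
  · exact hmax.dense_domain.mono fun z hz => hz.1

end IsDissipativeTriplet

omit [CompleteSpace Z] [CompleteSpace U] [CompleteSpace V] in
-- Along a solution the derivative of ‖z‖² is 2 Re⟨z, L z⟩, so passivity is a pointwise inequality
-- on the domain.
theorem Colligation.IsInternallyWellPosed.isScatteringPassive {Θ : Colligation U Z V}
    (h : Θ.IsInternallyWellPosed)
    (hΘ : ∀ z : Θ.dom, 2 * RCLike.re (inner ℂ (z : Z) (Θ.L z)) + ‖Θ.K z‖ ^ 2 ≤ ‖Θ.G z‖ ^ 2) :
    Θ.IsScatteringPassive := by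
  refine ⟨h, fun u z y hs t ht => ?_⟩
  let _ : InnerProductSpace ℝ Z := InnerProductSpace.complexToReal
  have h1 := (hs.state_eq t ht).norm_sq.derivWithin (uniqueDiffOn_Ici 0 t ht)
  rw [h1, hs.output_eq t ht, hs.input_eq t ht]
  exact hΘ (z t)

/-- G and K are ½((Γ₀ + Γ₁) ∓ P(Γ₀ - Γ₁)). Thus ker G carries the boundary contraction P, while the
Cayley transform with β = 1 has input (Γ₀ + Γ₁)/√2, whose kernel carries the contraction 0. -/
theorem IsDissipativeTriplet.isImpedancePassive {L : Z →ₗ.[ℂ] Z} {Γ₀ Γ₁ : L.domain →ₗ[ℂ] U}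
    (h : IsDissipativeTriplet L Γ₀ Γ₁) {P : U →L[ℂ] U} (hP : ‖P‖ ≤ 1) {G K : L.domain →ₗ[ℂ] U}
    (hG : ∀ z, G z = (1 / 2 : ℂ) • ((Γ₀ z - P (Γ₀ z)) + (Γ₁ z + P (Γ₁ z))))
    (hK : ∀ z, K z = (1 / 2 : ℂ) • ((Γ₀ z + P (Γ₀ z)) + (Γ₁ z - P (Γ₁ z)))) :
    (⟨L.domain, G, L.toFun, K⟩ : Colligation U Z U).IsInternallyWellPosed ∧
      (⟨L.domain, G, L.toFun, K⟩ : Colligation U Z U).IsImpedancePassive := by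
  have hPn : ∀ v, ‖P v‖ ≤ ‖v‖ := fun v => by simpa using P.le_of_opNorm_le hP v
  have hhalf : ‖(1 / 2 : ℂ)‖ = 1 / 2 := by simp
  have hGc : ∀ z, ‖G z‖ ≤ 1 * (‖Γ₀ z‖ + ‖Γ₁ z‖) := fun z => by
    rw [hG, norm_smul, hhalf]
    have h1 := norm_add_le (Γ₀ z - P (Γ₀ z)) (Γ₁ z + P (Γ₁ z))
    linarith [norm_sub_le (Γ₀ z) (P (Γ₀ z)), norm_add_le (Γ₁ z) (P (Γ₁ z)), hPn (Γ₀ z), hPn (Γ₁ z)]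
  have hKc : ∀ z, ‖K z‖ ≤ 1 * (‖Γ₀ z‖ + ‖Γ₁ z‖) := fun z => by
    rw [hK, norm_smul, hhalf]
    have h1 := norm_add_le (Γ₀ z + P (Γ₀ z)) (Γ₁ z - P (Γ₁ z))
    linarith [norm_add_le (Γ₀ z) (P (Γ₀ z)), norm_sub_le (Γ₁ z) (P (Γ₁ z)), hPn (Γ₀ z), hPn (Γ₁ z)]
  constructor
  · refine h.isInternallyWellPosed hP hGc hKc (fun g => ?_) fun z => ?_
    -- Equal boundary values g make the P-terms cancel, leaving G z = g.
    · obtain ⟨z, h0, h1⟩ := h.surjective g g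
      refine ⟨z, ?_⟩
      rw [hG, h0, h1]
      module
    · rw [hG, smul_eq_zero, or_iff_right (by norm_num), ← sub_eq_zero (b := P _), map_sub]
      constructor <;> intro h1 <;> rw [← h1] <;> abel
  · set s : ℂ := ((1 / Real.sqrt (2 * (1 : ℂ).re) : ℝ) : ℂ) with hs
    have hs2 : ‖s‖ ^ 2 = 1 / 2 := by
      rw [hs, Complex.norm_real, Real.norm_eq_abs, sq_abs, div_pow, Real.sq_sqrt (by simp)]
      simp
    have hs0 : s ≠ 0 := by
      intro h0
      rw [h0] at hs2
      norm_num at hs2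
    let G' : L.domain →ₗ[ℂ] U := s • ((1 : ℂ) • G + K)
    let K' : L.domain →ₗ[ℂ] U := s • (starRingEnd ℂ (1 : ℂ) • G - K)
    have hG' : ∀ z, G' z = s • (Γ₀ z + Γ₁ z) := fun z => by
      have h1 : G' z = s • ((1 : ℂ) • G z + K z) := rfl
      rw [h1, hG, hK]
      module
    have hK' : ∀ z, K' z = -(s • P (Γ₀ z - Γ₁ z)) := fun z => by
      have h1 : K' z = s • (starRingEnd ℂ (1 : ℂ) • G z - K z) := rfl
      rw [h1, hG, hK, map_one, map_sub]
      module
    have hs1 : ‖s‖ ≤ 1 := by nlinarith [norm_nonneg s]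
    have hwp : (⟨L.domain, G', L.toFun, K'⟩ : Colligation U Z U).IsInternallyWellPosed := by
      refine h.isInternallyWellPosed (Q := 0) (by simp) (c := 1) (fun z => ?_) (fun z => ?_)
        (fun v => ?_) fun z => ?_
      · rw [hG', norm_smul, one_mul]
        exact (mul_le_of_le_one_left (norm_nonneg _) hs1).trans (norm_add_le _ _)
      · rw [hK', norm_neg, norm_smul, one_mul]
        exact (mul_le_of_le_one_left (norm_nonneg _) hs1).trans ((hPn _).trans (norm_sub_le _ _))
      · obtain ⟨z, h0, h1⟩ := h.surjective (s⁻¹ • v) 0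
        refine ⟨z, ?_⟩
        rw [hG', h0, h1, add_zero, smul_inv_smul₀ hs0]
      · rw [hG', smul_eq_zero, or_iff_right hs0]
        rfl
    refine ⟨1, by simp, hwp.isScatteringPassive fun z => ?_⟩
    have key : ∀ z : L.domain,
        2 * RCLike.re (inner ℂ (z : Z) (L z)) + ‖K' z‖ ^ 2 ≤ ‖G' z‖ ^ 2 := fun z => by
      rw [hG', hK', norm_neg, norm_smul, norm_smul, mul_pow, mul_pow, hs2]
      have h1 := h.four_mul_re_inner_le z
      have h2 := pow_le_pow_left₀ (norm_nonneg _) (hPn (Γ₀ z - Γ₁ z)) 2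
      linarith
    exact key z

end Triplet

/-! ### Closed operators -/

section ClosedOperators

variable {X W : Type*} [NormedAddCommGroup X] [InnerProductSpace ℂ X] [CompleteSpace X]
  [NormedAddCommGroup W] [InnerProductSpace ℂ W] [CompleteSpace W]

omit [CompleteSpace W] in
theorem _root_.LinearPMap.IsClosed.isClosed_range {T : X →ₗ.[ℂ] W} (hT : T.IsClosed) {c : ℝ}
    (hc : 0 < c) (hcT : ∀ x : T.domain, c * ‖(x : X)‖ ≤ ‖T x‖) :
    IsClosed (LinearMap.range T.toFun : Set W) := by
  refine IsSeqClosed.isClosed fun p q hp hq => ?_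
  choose z hz using hp
  have hz' : ∀ n, T (z n) = p n := hz
  have h1 : CauchySeq fun n => (z n : X) := by
    refine Metric.cauchySeq_iff.mpr fun ε hε => ?_
    obtain ⟨N, hN⟩ := Metric.cauchySeq_iff.mp hq.cauchySeq (c * ε) (by positivity)
    refine ⟨N, fun m hm n hn => ?_⟩
    have h2 := hN m hm n hn
    have h3 := hcT (z m - z n)
    rw [T.map_sub, hz', hz', Submodule.coe_sub] at h3
    rw [dist_eq_norm] at h2 ⊢
    exact lt_of_mul_lt_mul_left (h3.trans_lt h2) hc.le
  obtain ⟨x, hx⟩ := cauchySeq_tendsto_of_complete h1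
  obtain ⟨w, -, hw⟩ := hT.exists_of_tendsto hx (b := q) (by simpa only [hz'] using hq)
  exact ⟨w, hw⟩

/-- Lax–Milgram for the form `⟨p w, N (p v)⟩ + ⟨q w, q v⟩`, with `N` coercive. -/
theorem exists_form_eq {V : Type*} [NormedAddCommGroup V] [InnerProductSpace ℂ V] [CompleteSpace V]
    (p : V →L[ℂ] X) (q : V →L[ℂ] W) (hpq : ∀ v, ‖v‖ ^ 2 ≤ ‖p v‖ ^ 2 + ‖q v‖ ^ 2)
    {N : X →L[ℂ] X} {c : ℝ} (hc : 0 < c) (hN : ∀ x, c * ‖x‖ ^ 2 ≤ RCLike.re (inner ℂ x (N x)))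
    (g : X) (f : W) :
    ∃ v, ∀ w, inner ℂ (p w) (N (p v)) + inner ℂ (q w) (q v) =
      inner ℂ (p w) g + inner ℂ (q w) f := by
  let Φ : V →L[ℂ] V := ContinuousLinearMap.adjoint p ∘L N ∘L p + ContinuousLinearMap.adjoint q ∘L q
  have hΦ : ∀ v w : V, inner ℂ v (Φ w) = inner ℂ (p v) (N (p w)) + inner ℂ (q v) (q w) :=
    fun v w => by
      have h1 : Φ w = ContinuousLinearMap.adjoint p (N (p w)) +
        ContinuousLinearMap.adjoint q (q w) := rfl
      rw [h1, inner_add_right, ContinuousLinearMap.adjoint_inner_right,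
        ContinuousLinearMap.adjoint_inner_right]
  have hpos : 0 < min c 1 := lt_min hc one_pos
  have hcoer : ∀ v : V, ‖v‖ ^ 2 * (min c 1) ≤ ‖inner ℂ (Φ v) v‖ := fun v => by
    rw [norm_inner_symm]
    refine le_trans ?_ (RCLike.re_le_norm _)
    rw [hΦ, map_add, re_inner_self]
    have h1 := hN (p v)
    have h2 := mul_le_mul_of_nonneg_left (min_le_left c 1) (sq_nonneg ‖p v‖)
    have h3 := mul_le_mul_of_nonneg_left (min_le_right c 1) (sq_nonneg ‖q v‖)
    have h4 := mul_le_mul_of_nonneg_right (hpq v) hpos.le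
    linarith
  have hu : IsUnit Φ := ContinuousLinearMap.isUnit_of_forall_le_norm_inner_map Φ
    (c := ⟨min c 1, hpos.le⟩) hpos hcoer
  obtain ⟨v, hv⟩ := (ContinuousLinearMap.isUnit_iff_bijective.mp hu).2
    (ContinuousLinearMap.adjoint p g + ContinuousLinearMap.adjoint q f)
  refine ⟨v, fun w => ?_⟩
  rw [← hΦ, hv, inner_add_right, ContinuousLinearMap.adjoint_inner_right,
    ContinuousLinearMap.adjoint_inner_right]

/-- Lax–Milgram for the form `⟨ξ, N x⟩ + ⟨T ξ, T x⟩` of a closed operator `T` and a bounded coercive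
operator `N`. -/
theorem _root_.LinearPMap.IsClosed.exists_form_eq {T : X →ₗ.[ℂ] W} (hT : T.IsClosed)
    {N : X →L[ℂ] X} {c : ℝ} (hc : 0 < c) (hN : ∀ x, c * ‖x‖ ^ 2 ≤ RCLike.re (inner ℂ x (N x)))
    (g : X) (f : W) :
    ∃ x : T.domain, ∀ ξ : T.domain, inner ℂ (ξ : X) (N x) + inner ℂ (T ξ) (T x) =
      inner ℂ (ξ : X) g + inner ℂ (T ξ) f := by
  -- The form domain is the graph of T as a Hilbert space, where the norm hypothesis of the abstract
  -- version is an equality.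
  let V : Submodule ℂ (WithLp 2 (X × W)) :=
    T.graph.comap ((WithLp.fstₗ 2 ℂ X W).prod (WithLp.sndₗ 2 ℂ X W))
  have hV : IsClosed (V : Set (WithLp 2 (X × W))) :=
    IsClosed.preimage ((WithLp.fstL 2 ℂ X W).continuous.prodMk (WithLp.sndL 2 ℂ X W).continuous) hT
  have : CompleteSpace V := hV.completeSpace_coe
  obtain ⟨v, hv⟩ := BoundaryNode.exists_form_eq (WithLp.fstL 2 ℂ X W ∘L V.subtypeL)
    (WithLp.sndL 2 ℂ X W ∘L V.subtypeL)
    (fun v => (WithLp.prod_norm_sq_eq_of_L2 (v : WithLp 2 (X × W))).le) hc hN g f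
  obtain ⟨x, hx1, hx2⟩ := T.mem_graph_iff.mp v.2
  refine ⟨x, fun ξ => ?_⟩
  have h1 := hv ⟨WithLp.toLp 2 ((ξ : X), T ξ), T.mem_graph ξ⟩
  rw [hx1, hx2]
  exact h1

omit [CompleteSpace X] [CompleteSpace W] in
theorem HasCoerciveForm.exists_norm_le {S : X →ₗ.[ℂ] X} (hS : HasCoerciveForm S) :
    ∃ c : ℝ, 0 < c ∧ ∀ x : S.domain, c * ‖(x : X)‖ ≤ ‖S x‖ := by
  obtain ⟨c, hc, h⟩ := hS
  refine ⟨c, hc, fun x => ?_⟩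
  have h1 := (h x).trans (re_inner_le_norm (𝕜 := ℂ) _ _)
  rcases (norm_nonneg (x : X)).eq_or_lt' with h0 | h0
  · rw [h0, mul_zero]; exact norm_nonneg _
  · refine le_of_mul_le_mul_left ?_ h0
    linarith [sq ‖(x : X)‖]

/-- The range is closed by coercivity, and its orthogonal complement is the kernel of S* = S, which
is zero. -/
theorem IsUniformlyPositive.surjective {S : X →ₗ.[ℂ] X} (hS : IsUniformlyPositive S) (f : X) :
    ∃ x : S.domain, S x = f := by
  obtain ⟨c, hc, h⟩ := hS.2.exists_norm_le
  have hcl : IsClosed (LinearMap.range S.toFun : Set X) := hS.1.isClosed.isClosed_range hc h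
  have htop : LinearMap.range S.toFun = ⊤ := by
    rw [← hcl.submodule_topologicalClosure_eq, Submodule.topologicalClosure_eq_top_iff,
      Submodule.eq_bot_iff]
    intro v hv
    have h0 : ∀ x : S.domain, inner ℂ (0 : X) (x : X) = inner ℂ v (S x) := fun x => by
      rw [inner_zero_left]
      exact ((Submodule.mem_orthogonal' _ _).mp hv _ ⟨x, rfl⟩).symm
    have h1 : v ∈ S.adjoint.domain := LinearPMap.mem_adjoint_domain_of_exists v ⟨0, h0⟩
    have h2 : S.adjoint ⟨v, h1⟩ = 0 := LinearPMap.adjoint_apply_eq hS.1.dense_domain _ h0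
    have h3 : S.adjoint = S := hS.1
    -- Stated for a variable T because the membership proof depends on the operator being rewritten.
    have h4 : ∀ T : X →ₗ.[ℂ] X, T = S → ∀ hv : v ∈ T.domain, T ⟨v, hv⟩ = 0 → v = 0 := by
      rintro T rfl hv hT
      have := h ⟨v, hv⟩
      rw [hT, norm_zero] at this
      have h5 : ‖v‖ ≤ 0 := by
        by_contra h6
        have := mul_pos hc (not_le.mp h6)
        linarith
      exact norm_le_zero_iff.mp h5
    exact h4 _ h3 h1 h2
  have : f ∈ LinearMap.range S.toFun := htop ▸ Submodule.mem_top
  exact this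

end ClosedOperators

/-! ### The operator A*A: closed range, core, and comparison of forms. -/

section Stiffness

variable {X Y : Type*} [NormedAddCommGroup X] [InnerProductSpace ℂ X] [CompleteSpace X]
  [NormedAddCommGroup Y] [InnerProductSpace ℂ Y] {A : X →ₗ.[ℂ] Y}

/-- Every `f` is of the form `A* A s`. -/
theorem exists_inner_apply_eq (hA : Dense (A.domain : Set X))
    (hS : IsUniformlyPositive (stiffness A)) (f : X) :
    ∃ s : A.domain, (∃ h : (s : X) ∈ (stiffness A).domain, stiffness A ⟨s, h⟩ = f) ∧
      ∀ x : A.domain, inner ℂ (A s) (A x) = inner ℂ f (x : X) := by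
  obtain ⟨⟨s, hs, hs'⟩, rfl⟩ := hS.surjective f
  exact ⟨⟨s, hs⟩, ⟨⟨hs, hs'⟩, rfl⟩,
    fun x => (LinearPMap.adjoint_isFormalAdjoint hA ⟨A ⟨s, hs⟩, hs'⟩ x).symm⟩

/-- Coercivity is given on dom A*A only. Solve A*A s = x: then ‖x‖² = ⟨As, Ax⟩ ≤ ‖As‖‖Ax‖ and ‖As‖²
= ⟨x, s⟩ ≤ ‖x‖²/c, whence the constant √c. -/
theorem exists_mul_norm_le (hA : Dense (A.domain : Set X))
    (hS : IsUniformlyPositive (stiffness A)) :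
    ∃ c : ℝ, 0 < c ∧ ∀ x : A.domain, c * ‖(x : X)‖ ≤ ‖A x‖ := by
  obtain ⟨c, hc, h⟩ := hS.2.exists_norm_le
  refine ⟨Real.sqrt c, Real.sqrt_pos.mpr hc, fun x => ?_⟩
  obtain ⟨s, ⟨h1, h2⟩, h3⟩ := exists_inner_apply_eq hA hS (x : X)
  have h4 := h ⟨s, h1⟩
  rw [h2] at h4
  have h5 : ‖A s‖ ^ 2 ≤ ‖(x : X)‖ * ‖(s : X)‖ := by
    rw [← re_inner_self, h3]
    exact re_inner_le_norm _ _
  have h6 : ‖(x : X)‖ ^ 2 ≤ ‖A s‖ * ‖A x‖ := by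
    rw [← re_inner_self, ← h3]
    exact re_inner_le_norm _ _
  have h7 : c * ‖A s‖ ^ 2 ≤ ‖(x : X)‖ ^ 2 := by
    have := mul_le_mul_of_nonneg_left h4 (norm_nonneg (x : X))
    have := mul_le_mul_of_nonneg_left h5 hc.le
    nlinarith
  refine le_of_sq_le_sq ?_ (norm_nonneg _)
  rw [mul_pow, Real.sq_sqrt hc.le]
  rcases (norm_nonneg (x : X)).eq_or_lt' with h0 | h0
  · rw [h0]; simp
  · have h8 : (‖(x : X)‖ ^ 2) ^ 2 ≤ (‖A s‖ * ‖A x‖) ^ 2 :=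
      pow_le_pow_left₀ (sq_nonneg _) h6 2
    refine le_of_mul_le_mul_left ?_ (pow_pos h0 2)
    calc ‖(x : X)‖ ^ 2 * (c * ‖(x : X)‖ ^ 2) = c * (‖(x : X)‖ ^ 2) ^ 2 := by ring
      _ ≤ c * (‖A s‖ * ‖A x‖) ^ 2 := by gcongr
      _ = (c * ‖A s‖ ^ 2) * ‖A x‖ ^ 2 := by ring
      _ ≤ _ := by gcongr

variable (hA_closed : A.IsClosed) (hA_dense : Dense (A.domain : Set X))
  (hS : IsUniformlyPositive (stiffness A))
include hA_closed hA_dense hS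

theorem isClosed_strainSpace : IsClosed (LinearMap.range A.toFun : Set Y) := by
  obtain ⟨c, hc, h⟩ := exists_mul_norm_le hA_dense hS
  exact hA_closed.isClosed_range hc h

/-- The domain of `A* A` is a core of `A`. -/
theorem exists_seq_tendsto_of_isClosed [CompleteSpace Y] (x : A.domain) :
    ∃ s : ℕ → A.domain, (∀ n, (s n : X) ∈ (stiffness A).domain) ∧
      Tendsto (fun n => (s n : X)) atTop (𝓝 x) ∧ Tendsto (fun n => A (s n)) atTop (𝓝 (A x)) := by
  obtain ⟨c, hc, h⟩ := exists_mul_norm_le hA_dense hS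
  have : CompleteSpace (StrainSpace A) :=
    (isClosed_strainSpace hA_closed hA_dense hS).completeSpace_coe
  let V : Submodule ℂ (StrainSpace A) :=
    (((stiffness A).domain.comap A.domain.subtype).map A.toFun.rangeRestrict)
  have hV : V.topologicalClosure = ⊤ := by
    rw [Submodule.topologicalClosure_eq_top_iff, Submodule.eq_bot_iff]
    rintro ⟨_, u, rfl⟩ hu
    -- If A u is orthogonal to A(dom A*A), test with A*A s = u: 0 = ⟨As, Au⟩ = ‖u‖².
    obtain ⟨s, ⟨h1, h2⟩, h3⟩ := exists_inner_apply_eq hA_dense hS (u : X)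
    have h4 : inner ℂ (A s) (A u) = 0 :=
      (Submodule.mem_orthogonal _ _).mp hu (A.toFun.rangeRestrict s) ⟨s, h1, rfl⟩
    rw [h3, inner_self_eq_zero] at h4
    have h5 : u = 0 := Subtype.ext h4
    subst h5
    exact Subtype.ext A.map_zero
  have hx : A.toFun.rangeRestrict x ∈ closure (V : Set (StrainSpace A)) := by
    have : A.toFun.rangeRestrict x ∈ V.topologicalClosure := hV ▸ Submodule.mem_top
    exact this
  obtain ⟨v, hv, hlim⟩ := mem_closure_iff_seq_limit.mp hx
  choose s hs1 hs2 using hv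
  have hlim' : Tendsto (fun n => A (s n)) atTop (𝓝 (A x)) := by
    have := (continuous_subtype_val.tendsto (A.toFun.rangeRestrict x)).comp hlim
    refine this.congr fun n => ?_
    rw [Function.comp_apply, ← hs2]
    rfl
  refine ⟨s, hs1, ?_, hlim'⟩
  rw [tendsto_iff_norm_sub_tendsto_zero] at hlim' ⊢
  refine squeeze_zero (fun _ => norm_nonneg _) (fun n => ?_)
    (by simpa using hlim'.const_mul c⁻¹)
  rw [← A.map_sub, ← Submodule.coe_sub, inv_mul_eq_div, le_div_iff₀ hc, mul_comm]
  exact h _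

/-- If `A* A = R* R` with `A` and `R` closed, then `A ⊆ R` in the sense of quadratic forms. -/
theorem mem_domain_of_stiffness_eq [CompleteSpace Y] {W : Type*} [NormedAddCommGroup W]
    [InnerProductSpace ℂ W] [CompleteSpace W] {R : X →ₗ.[ℂ] W} (hR_closed : R.IsClosed)
    (hR_dense : Dense (R.domain : Set X)) (h : stiffness R = stiffness A) (x : A.domain) :
    ∃ hx : (x : X) ∈ R.domain, ‖R ⟨x, hx⟩‖ = ‖A x‖ := by
  have hmem : ∀ s : A.domain, (s : X) ∈ (stiffness A).domain → (s : X) ∈ (stiffness R).domain :=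
    fun s hs => by rwa [h]
  -- Both squared norms equal ⟨A*A s, s⟩. The core property and closedness of R then carry the
  -- equality to all of dom A.
  have hnorm : ∀ s : A.domain, ∀ hs : (s : X) ∈ (stiffness A).domain,
      ∀ hs' : (s : X) ∈ R.domain, ‖R ⟨s, hs'⟩‖ = ‖A s‖ := by
    intro s hs hs'
    have h1 : ∀ T : X →ₗ.[ℂ] X, T = stiffness A → ∀ h : (s : X) ∈ T.domain,
        T ⟨s, h⟩ = stiffness A ⟨s, hs⟩ := by rintro T rfl h; rfl
    have h2 := h1 _ h (hmem s hs)
    have h3 : inner ℂ (stiffness A ⟨s, hs⟩) (s : X) = inner ℂ (A s) (A s) :=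
      LinearPMap.adjoint_isFormalAdjoint hA_dense ⟨A s, hs.2⟩ s
    have h4 : inner ℂ (stiffness R ⟨s, hmem s hs⟩) (s : X) =
        inner ℂ (R ⟨s, hs'⟩) (R ⟨s, hs'⟩) :=
      LinearPMap.adjoint_isFormalAdjoint hR_dense ⟨R ⟨s, hs'⟩, (hmem s hs).2⟩ ⟨s, hs'⟩
    rw [h2, h3] at h4
    have h5 := congrArg RCLike.re h4
    rw [re_inner_self, re_inner_self] at h5
    exact ((pow_left_inj₀ (norm_nonneg _) (norm_nonneg _) two_ne_zero).mp h5).symm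
  obtain ⟨s, hs, hs1, hs2⟩ := exists_seq_tendsto_of_isClosed hA_closed hA_dense hS x
  let r : ℕ → R.domain := fun n => ⟨s n, (hmem _ (hs n)).1⟩
  have hr : CauchySeq fun n => R (r n) := by
    refine Metric.cauchySeq_iff.mpr fun ε hε => ?_
    obtain ⟨N, hN⟩ := Metric.cauchySeq_iff.mp hs2.cauchySeq ε hε
    refine ⟨N, fun m hm n hn => ?_⟩
    have h1 := hN m hm n hn
    rw [dist_eq_norm, ← LinearPMap.map_sub] at h1 ⊢
    rwa [← hnorm (s m - s n) (Submodule.sub_mem _ (hs m) (hs n)) (r m - r n).2] at h1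
  obtain ⟨w, hw⟩ := cauchySeq_tendsto_of_complete hr
  obtain ⟨y, hy, rfl⟩ := hR_closed.exists_of_tendsto (z := r) hs1 hw
  refine ⟨hy ▸ y.2, ?_⟩
  have e : (⟨x, hy ▸ y.2⟩ : R.domain) = y := Subtype.ext hy.symm
  rw [e]
  refine tendsto_nhds_unique hw.norm (hs2.norm.congr fun n => ?_)
  exact (hnorm (s n) (hs n) _).symm

end Stiffness

/-! ### The second-order boundary node -/

section AntiDual

variable {G G₁ G₂ : Type*} [NormedAddCommGroup G] [InnerProductSpace ℂ G] [CompleteSpace G]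
  [NormedAddCommGroup G₁] [InnerProductSpace ℂ G₁] [NormedAddCommGroup G₂] [InnerProductSpace ℂ G₂]

theorem riesz_apply (g x : G) : riesz G g x = inner ℂ x g := rfl

theorem inner_riesz_left (g : G) (φ : AntiDual G) : inner ℂ (riesz G g) φ = φ g := by
  obtain ⟨x, rfl⟩ := (riesz G).surjective φ
  change inner ℂ ((riesz G).symm (riesz G g)) ((riesz G).symm (riesz G x)) = _
  rw [LinearIsometryEquiv.symm_apply_apply, LinearIsometryEquiv.symm_apply_apply, riesz_apply]

theorem antiDual_conj_inner (φ ψ : AntiDual G) :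
    starRingEnd ℂ (inner ℂ φ ψ) = inner ℂ ψ φ :=
  inner_conj_symm ((riesz G).symm ψ) ((riesz G).symm φ)

theorem inner_riesz_right (g : G) (φ : AntiDual G) :
    inner ℂ φ (riesz G g) = starRingEnd ℂ (φ g) := by
  rw [← antiDual_conj_inner, inner_riesz_left]

theorem antiDualProd_apply (φ : AntiDual G₁ × AntiDual G₂) (g : WithLp 2 (G₁ × G₂)) :
    antiDualProd G₁ G₂ φ g = φ.1 g.fst + φ.2 g.snd := rfl

theorem antiDualProd_surjective (φ : AntiDual (WithLp 2 (G₁ × G₂))) :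
    ∃ φ₁ φ₂, antiDualProd G₁ G₂ (φ₁, φ₂) = φ := by
  let e := (WithLp.prodContinuousLinearEquiv 2 ℂ G₁ G₂).symm
  refine ⟨φ.comp ((e : G₁ × G₂ →L[ℂ] _).comp (ContinuousLinearMap.inl ℂ G₁ G₂)),
    φ.comp ((e : G₁ × G₂ →L[ℂ] _).comp (ContinuousLinearMap.inr ℂ G₁ G₂)), ?_⟩
  ext g
  rw [antiDualProd_apply]
  change φ (WithLp.toLp 2 (g.fst, 0)) + φ (WithLp.toLp 2 (0, g.snd)) = φ g
  rw [← map_add]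
  congr 1
  refine (WithLp.linearEquiv 2 ℂ (G₁ × G₂)).injective (Prod.ext ?_ ?_)
  · exact add_zero g.fst
  · exact zero_add g.snd

end AntiDual

/-! ### The weighted space X_M and its equivalence with X. -/

section Momentum

variable {X : Type*} [NormedAddCommGroup X] [InnerProductSpace ℂ X] [CompleteSpace X]
  {M : X →L[ℂ] X} (hM : IsBddUniformlyPositive M)
include hM

theorem massInv_mass (x : X) : massInv M (M x) = x := by
  have h0 : M (massInv M (M x) - x) = 0 := by rw [map_sub, mass_massInv hM, sub_self]
  obtain ⟨c, hc, h⟩ := hM.2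
  have h1 := h (massInv M (M x) - x)
  rw [h0, inner_zero_right, map_zero] at h1
  have h2 : ‖massInv M (M x) - x‖ ^ 2 ≤ 0 := by
    by_contra h3
    have := mul_pos hc (not_le.mp h3)
    linarith
  have h3 : ‖massInv M (M x) - x‖ = 0 := by
    nlinarith [norm_nonneg (massInv M (M x) - x)]
  exact sub_eq_zero.mp (norm_eq_zero.mp h3)

theorem inner_massInv (x y : X) : inner ℂ (massInv M x) y = inner ℂ x (massInv M y) := by
  have h := ContinuousLinearMap.isSelfAdjoint_iff_isSymmetric.mp hM.1 (massInv M x) (massInv M y)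
  simp only [ContinuousLinearMap.coe_coe, mass_massInv hM] at h
  exact h.symm

namespace MomentumSpace

/-- The weight M⁻¹ turns a momentum into a velocity; this reduces energy identities to the inner
product of X. -/
theorem inner_of_right (w : MomentumSpace M hM) (x : X) :
    inner ℂ w (of M hM x) = inner ℂ (velocity M hM w) x :=
  (inner_massInv hM _ _).symm

theorem inner_of_left (w : MomentumSpace M hM) (x : X) :
    inner ℂ (of M hM x) w = inner ℂ x (velocity M hM w) := rfl

theorem norm_of_le (x : X) : ‖of M hM x‖ ≤ Real.sqrt ‖massInv M‖ * ‖x‖ := by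
  refine le_of_sq_le_sq ?_ (by positivity)
  rw [mul_pow, Real.sq_sqrt (norm_nonneg _), ← re_inner_self, inner_of_left]
  refine (re_inner_le_norm _ _).trans ?_
  have h : ‖velocity M hM (of M hM x)‖ ≤ ‖massInv M‖ * ‖x‖ := (massInv M).le_opNorm x
  nlinarith [norm_nonneg x]

theorem exists_norm_symm_le : ∃ C : ℝ, ∀ w : MomentumSpace M hM, ‖(of M hM).symm w‖ ≤ C * ‖w‖ := by
  obtain ⟨c, hc, h⟩ := hM.2
  refine ⟨‖M‖ * Real.sqrt c⁻¹, fun w => ?_⟩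
  have h1 := h (velocity M hM w)
  have h2 : M (velocity M hM w) = (of M hM).symm w := mass_massInv hM _
  rw [h2, ← inner_of_right, LinearEquiv.apply_symm_apply, re_inner_self] at h1
  have h3 : ‖velocity M hM w‖ ≤ Real.sqrt c⁻¹ * ‖w‖ := by
    refine le_of_sq_le_sq ?_ (by positivity)
    rw [mul_pow, Real.sq_sqrt (inv_nonneg.mpr hc.le), inv_mul_eq_div, le_div_iff₀ hc, mul_comm]
    exact h1
  rw [← h2, mul_assoc]
  exact (M.le_opNorm _).trans (mul_le_mul_of_nonneg_left h3 (norm_nonneg _))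

theorem exists_continuousLinearEquiv :
    ∃ e : X ≃L[ℂ] MomentumSpace M hM, (e : X ≃ₗ[ℂ] MomentumSpace M hM) = of M hM := by
  obtain ⟨C, hC⟩ := exists_norm_symm_le hM
  exact ⟨(of M hM).toContinuousLinearEquivOfBounds _ C (norm_of_le hM) hC, rfl⟩

theorem continuous_of : Continuous (of M hM) := by
  obtain ⟨e, he⟩ := exists_continuousLinearEquiv hM
  rw [← he]
  exact e.continuous

theorem continuous_of_symm : Continuous (of M hM).symm := by
  obtain ⟨e, he⟩ := exists_continuousLinearEquiv hM
  rw [← he]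
  exact e.symm.continuous

theorem completeSpace : CompleteSpace (MomentumSpace M hM) := by
  obtain ⟨e, -⟩ := exists_continuousLinearEquiv hM
  exact (completeSpace_congr (e := e.toEquiv) e.isUniformEmbedding).mp inferInstance

end MomentumSpace

theorem continuous_velocity : Continuous (velocity M hM) :=
  (massInv M).continuous.comp (MomentumSpace.continuous_of_symm hM)

end Momentum

/-! ### Boundary values and the stationary problem. -/

namespace DualPairTriplet

variable {X Y G₁ G₂ : Type*}
  [NormedAddCommGroup X] [InnerProductSpace ℂ X] [CompleteSpace X]
  [NormedAddCommGroup Y] [InnerProductSpace ℂ Y]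
  [NormedAddCommGroup G₁] [InnerProductSpace ℂ G₁] [CompleteSpace G₁]
  [NormedAddCommGroup G₂] [InnerProductSpace ℂ G₂] [CompleteSpace G₂]
  {A : X →ₗ.[ℂ] Y} {B : Y →ₗ.[ℂ] X} (t : DualPairTriplet A B G₁ G₂)

omit [CompleteSpace X] [CompleteSpace G₁] [CompleteSpace G₂] in
theorem exists_lam_eq (a : G₁) (b : AntiDual G₂) : ∃ x, t.lam₁ x = a ∧ t.lam₂ x = b := by
  obtain ⟨x, hx⟩ := t.surjective_lam (a, b)
  exact ⟨x, congrArg Prod.fst hx, congrArg Prod.snd hx⟩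

omit [CompleteSpace X] [CompleteSpace G₁] [CompleteSpace G₂] in
theorem exists_pi_eq (a : AntiDual G₁) (b : G₂) : ∃ y, t.pi₁ y = a ∧ t.pi₂ y = b := by
  obtain ⟨y, hy⟩ := t.surjective_pi (a, b)
  exact ⟨y, congrArg Prod.fst hy, congrArg Prod.snd hy⟩

omit [CompleteSpace X] [CompleteSpace G₁] in
-- The left side of the Green identity vanishes, so Πy pairs to zero with every Λx; surjectivity of
-- Λ separates the two components.
theorem pi_eq_zero {y : B.domain}
    (h : ∀ x : A.domain, inner ℂ (x : X) (B y) + inner ℂ (A x) (y : Y) = 0) :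
    t.pi₁ y = 0 ∧ t.pi₂ y = 0 := by
  have h1 : ∀ x, t.pi₁ y (t.lam₁ x) = starRingEnd ℂ (t.lam₂ x (t.pi₂ y)) := fun x => by
    rw [← sub_eq_zero, ← t.green]
    linear_combination -(h x)
  constructor
  · ext g
    obtain ⟨x, hx1, hx2⟩ := t.exists_lam_eq g 0
    rw [← hx1, h1, hx2]
    simp
  · obtain ⟨x, hx1, hx2⟩ := t.exists_lam_eq 0 (riesz G₂ (t.pi₂ y))
    have h2 := h1 x
    rw [hx1, hx2, map_zero, riesz_apply, eq_comm, map_eq_zero, inner_self_eq_zero] at h2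
    exact h2

variable (hAB : A.adjoint ≤ -B) (hA_dense : Dense (A.domain : Set X))

omit [CompleteSpace G₁] in
include t hAB hA_dense in
/-- On the domain of `A*`, `B` is `-A*` and the boundary map `pi` vanishes. -/
theorem exists_of_forall_inner_eq {y : Y} {f : X}
    (h : ∀ x : A.domain, inner ℂ (A x) y = inner ℂ (x : X) f) :
    ∃ hy : y ∈ B.domain, B ⟨y, hy⟩ = -f ∧ t.pi₁ ⟨y, hy⟩ = 0 ∧ t.pi₂ ⟨y, hy⟩ = 0 := by
  have h1 : ∀ x : A.domain, inner ℂ f (x : X) = inner ℂ y (A x) := fun x => by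
    rw [← inner_conj_symm, ← h, inner_conj_symm]
  have h2 : y ∈ A.adjoint.domain := LinearPMap.mem_adjoint_domain_of_exists y ⟨f, h1⟩
  have h3 : A.adjoint ⟨y, h2⟩ = f := LinearPMap.adjoint_apply_eq hA_dense _ h1
  have h4 : y ∈ B.domain := hAB.1 h2
  have h5 : A.adjoint ⟨y, h2⟩ = -B ⟨y, h4⟩ := hAB.2 (x := ⟨y, h2⟩) (y := ⟨y, h4⟩) rfl
  have h6 : B ⟨y, h4⟩ = -f := by rw [← h3, h5, neg_neg]
  refine ⟨h4, h6, t.pi_eq_zero fun x => ?_⟩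
  rw [h6, inner_neg_right, h, neg_add_cancel]

omit [CompleteSpace G₁] in
include t hAB hA_dense in
-- Project y orthogonally onto ran A. The discarded part lies in ker A*, hence in dom B with
-- vanishing boundary values.
theorem exists_pi_inclB_eq [CompleteSpace Y] (hA_range : IsClosed (LinearMap.range A.toFun : Set Y))
    (a : AntiDual G₁) (b : G₂) :
    ∃ y, t.pi₁ (inclB A B y) = a ∧ t.pi₂ (inclB A B y) = b := by
  obtain ⟨y, rfl, rfl⟩ := t.exists_pi_eq a b
  have : CompleteSpace (StrainSpace A) := hA_range.completeSpace_coe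
  have : (LinearMap.range A.toFun).HasOrthogonalProjection := inferInstance
  obtain ⟨y₁, hy₁, y₂, hy₂, hy⟩ := (LinearMap.range A.toFun).exists_add_mem_mem_orthogonal (y : Y)
  obtain ⟨h1, h2, h3, h4⟩ := t.exists_of_forall_inner_eq hAB hA_dense (y := y₂) (f := 0) fun x => by
    rw [inner_zero_right]
    exact (Submodule.mem_orthogonal _ _).mp hy₂ _ ⟨x, rfl⟩
  have h5 : y₁ ∈ B.domain := by
    have : y₁ = y - y₂ := by rw [hy, add_sub_cancel_right]
    rw [this]
    exact B.domain.sub_mem y.2 h1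
  have h6 : (⟨y₁, h5⟩ : B.domain) = y - ⟨y₂, h1⟩ :=
    Subtype.ext (by rw [Submodule.coe_sub, hy, add_sub_cancel_right])
  refine ⟨⟨⟨y₁, hy₁⟩, h5⟩, ?_, ?_⟩
  · change t.pi₁ ⟨y₁, h5⟩ = _
    rw [h6, map_sub, h3, sub_zero]
  · change t.pi₂ ⟨y₁, h5⟩ = _
    rw [h6, map_sub, h4, sub_zero]

/-- The operator `x ↦ (s A x, lam x)`. -/
def extended (t : DualPairTriplet A B G₁ G₂) (s : ℂ) :
    X →ₗ.[ℂ] WithLp 2 (Y × WithLp 2 (G₁ × AntiDual G₂)) where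
  domain := A.domain
  toFun := (WithLp.linearEquiv 2 ℂ _).symm.toLinearMap ∘ₗ (s • A.toFun).prod
    ((WithLp.linearEquiv 2 ℂ _).symm.toLinearMap ∘ₗ t.lam₁.prod t.lam₂)

omit [CompleteSpace X] [CompleteSpace G₁] in
theorem inner_extended (s : ℂ) (x : A.domain) (y : Y) (a : G₁) (b : AntiDual G₂) :
    inner ℂ (t.extended s x) (WithLp.toLp 2 (y, WithLp.toLp 2 (a, b))) =
      inner ℂ (s • A x) y + (inner ℂ (t.lam₁ x) a + inner ℂ (t.lam₂ x) b) := by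
  rw [WithLp.prod_inner_apply, ← WithLp.prod_inner_apply (WithLp.toLp 2 (t.lam₁ x, t.lam₂ x))
    (WithLp.toLp 2 (a, b))]
  rfl

omit [CompleteSpace X] in
-- Closedness of A gives the limit point; the Green identity against all y in dom B, with Π
-- surjective, identifies the limit of the boundary values.
theorem extended_isClosed (hA_closed : A.IsClosed) {s : ℂ} (hs : s ≠ 0) :
    (t.extended s).IsClosed := by
  refine LinearPMap.isClosed_of_forall_tendsto fun z x p hx hp => ?_
  have h1 : Tendsto (fun n => s • A (z n)) atTop (𝓝 p.fst) :=
    ((WithLp.fstL 2 ℂ Y (WithLp 2 (G₁ × AntiDual G₂))).continuous.tendsto p).comp hp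
  have h2 : Tendsto (fun n => WithLp.toLp 2 (t.lam₁ (z n), t.lam₂ (z n))) atTop (𝓝 p.snd) :=
    ((WithLp.sndL 2 ℂ Y (WithLp 2 (G₁ × AntiDual G₂))).continuous.tendsto p).comp hp
  have h3 : Tendsto (fun n => t.lam₁ (z n)) atTop (𝓝 p.snd.fst) :=
    ((WithLp.fstL 2 ℂ G₁ (AntiDual G₂)).continuous.tendsto _).comp h2
  have h4 : Tendsto (fun n => t.lam₂ (z n)) atTop (𝓝 p.snd.snd) :=
    ((WithLp.sndL 2 ℂ G₁ (AntiDual G₂)).continuous.tendsto _).comp h2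
  have h5 : Tendsto (fun n => A (z n)) atTop (𝓝 (s⁻¹ • p.fst)) := by
    simpa only [inv_smul_smul₀ hs] using h1.const_smul s⁻¹
  obtain ⟨w, rfl, hw⟩ := hA_closed.exists_of_tendsto hx h5
  have h6 : ∀ y, t.pi₁ y p.snd.fst - starRingEnd ℂ (p.snd.snd (t.pi₂ y)) =
      t.pi₁ y (t.lam₁ w) - starRingEnd ℂ (t.lam₂ w (t.pi₂ y)) := fun y => by
    refine tendsto_nhds_unique (f := fun n => t.pi₁ y (t.lam₁ (z n)) -
      starRingEnd ℂ (t.lam₂ (z n) (t.pi₂ y))) (l := atTop) ?_ ?_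
    · refine (((t.pi₁ y).continuous.tendsto _).comp h3).sub
        ((Complex.continuous_conj.tendsto _).comp ?_)
      have h7 : Continuous fun φ : AntiDual G₂ => φ (t.pi₂ y) := by
        have := (innerSL ℂ (riesz G₂ (t.pi₂ y))).continuous
        refine this.congr fun φ => ?_
        exact inner_riesz_left _ _
      exact (h7.tendsto _).comp h4
    · refine Tendsto.congr (fun n => t.green y (z n)) ?_
      rw [← t.green, hw]
      exact ((hx.inner (𝕜 := ℂ) tendsto_const_nhds).neg).sub
        (h5.inner (𝕜 := ℂ) tendsto_const_nhds)
  have h7 : p.snd.fst = t.lam₁ w := by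
    obtain ⟨y, hy1, hy2⟩ := t.exists_pi_eq (riesz G₁ (p.snd.fst - t.lam₁ w)) 0
    have := h6 y
    rw [hy1, hy2, map_zero (p.snd.snd), map_zero (t.lam₂ w), map_zero, sub_zero, sub_zero,
      riesz_apply, riesz_apply, ← sub_eq_zero, ← inner_sub_left, inner_self_eq_zero] at this
    exact sub_eq_zero.mp this
  have h8 : p.snd.snd = t.lam₂ w := by
    ext b
    obtain ⟨y, hy1, hy2⟩ := t.exists_pi_eq 0 b
    have := h6 y
    rw [hy1, hy2] at this
    exact (starRingEnd ℂ).injective (by simpa using this)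
  refine ⟨w, rfl, ?_⟩
  have h9 : t.extended s w = WithLp.toLp 2 (s • A w, WithLp.toLp 2 (t.lam₁ w, t.lam₂ w)) := rfl
  rw [h9, hw, smul_inv_smul₀ hs, ← h7, ← h8]
  rfl

include hAB hA_dense in
/-- Solvability of the stationary problem with impedance boundary condition. -/
theorem exists_stationary [CompleteSpace Y] (hA_closed : A.IsClosed) {N : X →L[ℂ] X} {c : ℝ}
    (hc : 0 < c) (hN : ∀ x, c * ‖x‖ ^ 2 ≤ RCLike.re (inner ℂ x (N x))) {μ : ℝ} (hμ : 0 < μ)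
    (f : Y) (g : X) :
    ∃ (x : A.domain) (y : B.domain), (μ : ℂ) • (y : Y) = f + A x ∧ N x - B y = g ∧
      t.pi₁ y = riesz G₁ (t.lam₁ x) ∧ riesz G₂ (t.pi₂ y) = -t.lam₂ x := by
  -- Scaling A by s gives the form its term μ⁻¹⟨Aξ, Ax⟩.
  set s : ℂ := ((Real.sqrt μ⁻¹ : ℝ) : ℂ) with hs
  have hs2 : s * s = (μ : ℂ)⁻¹ := by
    rw [hs, ← Complex.ofReal_mul, Real.mul_self_sqrt (inv_nonneg.mpr hμ.le), Complex.ofReal_inv]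
  have hμ0 : (μ : ℂ) ≠ 0 := by exact_mod_cast hμ.ne'
  have hs0 : s ≠ 0 := by
    rintro h0
    rw [h0, mul_zero, eq_comm, inv_eq_zero] at hs2
    exact hμ0 hs2
  have hsc : starRingEnd ℂ s = s := Complex.conj_ofReal _
  obtain ⟨(x : A.domain), hx⟩ := (t.extended_isClosed hA_closed hs0).exists_form_eq hc hN g
    (WithLp.toLp 2 (-(s • f), WithLp.toLp 2 (0, 0)))
  have hx' : ∀ ξ : A.domain, inner ℂ (ξ : X) (N x - g) +
      inner ℂ (A ξ) ((μ : ℂ)⁻¹ • (f + A x)) +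
      (inner ℂ (t.lam₁ ξ) (t.lam₁ x) + inner ℂ (t.lam₂ ξ) (t.lam₂ x)) = 0 := by
    intro ξ
    have h1 := hx ξ
    have h2 : t.extended s x = WithLp.toLp 2 (s • A x, WithLp.toLp 2 (t.lam₁ x, t.lam₂ x)) := rfl
    rw [h2, t.inner_extended, t.inner_extended] at h1
    simp only [inner_smul_left, inner_smul_right, inner_neg_right, inner_zero_right, hsc,
      inner_add_right, inner_sub_right] at h1 ⊢
    linear_combination h1 - hs2 * inner ℂ (A ξ) (A x) - hs2 * inner ℂ (A ξ) f
  set y : Y := (μ : ℂ)⁻¹ • (f + A x) with hy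
  -- It is not yet known that y lies in dom B. Take y' in dom B with the required boundary values;
  -- the weak equation then says y - y' lies in dom A*, so y is in dom B with the boundary values of
  -- y'.
  obtain ⟨y', hy1, hy2⟩ := t.exists_pi_eq (riesz G₁ (t.lam₁ x)) ((riesz G₂).symm (-t.lam₂ x))
  obtain ⟨h1, h2, h3, h4⟩ := t.exists_of_forall_inner_eq hAB hA_dense (y := y - y')
    (f := B y' - (N x - g)) fun ξ => by
      have h5 := t.green y' ξ
      have h6 : t.lam₂ ξ (t.pi₂ y') = -inner ℂ (t.lam₂ x) (t.lam₂ ξ) := by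
        rw [← inner_riesz_left, hy2, LinearIsometryEquiv.apply_symm_apply, inner_neg_left]
      rw [h6, hy1, riesz_apply, map_neg, antiDual_conj_inner] at h5
      have h7 := hx' ξ
      rw [inner_sub_right, inner_sub_right (ξ : X)]
      linear_combination h7 + h5
  have h5 : y ∈ B.domain := by
    have := B.domain.add_mem h1 y'.2
    rwa [sub_add_cancel] at this
  have h6 : (⟨y, h5⟩ : B.domain) = ⟨y - y', h1⟩ + y' := Subtype.ext (sub_add_cancel _ _).symm
  refine ⟨x, ⟨y, h5⟩, ?_, ?_, ?_, ?_⟩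
  · exact smul_inv_smul₀ hμ0 _
  · rw [h6, B.map_add, h2]
    abel
  · rw [h6, map_add, h3, hy1, zero_add]
  · rw [h6, map_add, h4, hy2, zero_add, LinearIsometryEquiv.apply_symm_apply]

end DualPairTriplet

/-! ### The strain–momentum operator. -/

section StrainMomentum

variable {X Y : Type*} [NormedAddCommGroup X] [InnerProductSpace ℂ X] [CompleteSpace X]
  [NormedAddCommGroup Y] [InnerProductSpace ℂ Y] (A : X →ₗ.[ℂ] Y) (B : Y →ₗ.[ℂ] X)
  (M D : X →L[ℂ] X) (hM : IsBddUniformlyPositive M)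

theorem conjugate_positionMomentum (hS : IsUniformlyPositive (stiffness A)) :
    conjugate (diagIso A M hS hM).toLinearEquiv (positionMomentum A B M D hS hM) =
      strainMomentum A B M D hM := by
  have hfst : ∀ w, strainIso A hS ((diagIso A M hS hM).symm w).fst = w.fst := fun w =>
    (strainIso A hS).apply_symm_apply w.fst
  refine LinearPMap.ext ?_ ?_
  · ext w
    change strainIso A hS ((diagIso A M hS hM).symm w).fst ∈ (strainRestrict A B).domain ∧ _ ↔ _
    rw [hfst]
    rfl
  · intro w h1 h2
    change diagIso A M hS hM (positionMomentum A B M D hS hM ⟨(diagIso A M hS hM).symm w, h1⟩) = _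
    rw [positionMomentum_apply, strainMomentum_apply]
    have h4 : (⟨strainIso A hS ((diagIso A M hS hM).symm w).fst, h1.1⟩ :
        (strainRestrict A B).domain) = ⟨w.fst, h2.1⟩ := Subtype.ext (hfst w)
    refine (WithLp.linearEquiv 2 ℂ _).injective (Prod.ext rfl ?_)
    change MomentumSpace.of M hM (strainRestrict A B ⟨strainIso A hS
      ((diagIso A M hS hM).symm w).fst, h1.1⟩ - _) = _
    rw [h4]
    rfl

/-- The velocity converges with the state and D is bounded, so the damping term can be moved aside
and the rows reduce to closedness of A and of B. -/
theorem strainMomentum_isClosed (hA : A.IsClosed) (hB : B.IsClosed) :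
    (strainMomentum A B M D hM).IsClosed := by
  refine LinearPMap.isClosed_of_forall_tendsto fun z a b ha hb => ?_
  let v : ℕ → A.domain := fun n => ⟨velocity M hM (z n).1.snd, (z n).2.2⟩
  let y : ℕ → B.domain := fun n => ⟨(z n).1.fst, (z n).2.1⟩
  have h1 : Tendsto (fun n => (y n : Y)) atTop (𝓝 a.fst) :=
    ((continuous_subtype_val.comp
      (WithLp.fstL 2 ℂ (StrainSpace A) (MomentumSpace M hM)).continuous).tendsto a).comp ha
  have h2 : Tendsto (fun n => (v n : X)) atTop (𝓝 (velocity M hM a.snd)) :=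
    (((continuous_velocity hM).comp
      (WithLp.sndL 2 ℂ (StrainSpace A) (MomentumSpace M hM)).continuous).tendsto a).comp ha
  have h3 : Tendsto (fun n => A (v n)) atTop (𝓝 b.fst) :=
    ((continuous_subtype_val.comp
      (WithLp.fstL 2 ℂ (StrainSpace A) (MomentumSpace M hM)).continuous).tendsto b).comp hb
  have h4 : Tendsto (fun n => B (y n) - D (v n)) atTop (𝓝 ((MomentumSpace.of M hM).symm b.snd)) :=
    (((MomentumSpace.continuous_of_symm hM).comp
      (WithLp.sndL 2 ℂ (StrainSpace A) (MomentumSpace M hM)).continuous).tendsto b).comp hb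
  have h5 : Tendsto (fun n => B (y n)) atTop
      (𝓝 ((MomentumSpace.of M hM).symm b.snd + D (velocity M hM a.snd))) := by
    simpa only [Function.comp_def, sub_add_cancel] using h4.add ((D.continuous.tendsto _).comp h2)
  obtain ⟨v', hv1, hv2⟩ := hA.exists_of_tendsto h2 h3
  obtain ⟨y', hy1, hy2⟩ := hB.exists_of_tendsto h1 h5
  have hy : (a.fst : Y) ∈ B.domain := hy1 ▸ y'.2
  have hv : velocity M hM a.snd ∈ A.domain := hv1 ▸ v'.2
  have ey : y' = ⟨a.fst, hy⟩ := Subtype.ext hy1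
  have ev : v' = ⟨velocity M hM a.snd, hv⟩ := Subtype.ext hv1
  subst ey ev
  refine ⟨⟨a, hy, hv⟩, rfl, ?_⟩
  rw [strainMomentum_apply]
  refine (WithLp.linearEquiv 2 ℂ _).injective (Prod.ext (Subtype.ext hv2) ?_)
  change MomentumSpace.of M hM (B ⟨a.fst, hy⟩ - D (velocity M hM a.snd)) = b.snd
  rw [hy2, add_sub_cancel_right, LinearEquiv.apply_symm_apply]

/-- The damping operator on the state space. -/
def damping : WithLp 2 (StrainSpace A × MomentumSpace M hM) →L[ℂ]
    WithLp 2 (StrainSpace A × MomentumSpace M hM) where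
  toLinearMap := (WithLp.linearEquiv 2 ℂ (StrainSpace A × MomentumSpace M hM)).symm.toLinearMap ∘ₗ
    (LinearMap.prod 0 ((MomentumSpace.of M hM).toLinearMap ∘ₗ D.toLinearMap ∘ₗ
      velocity M hM ∘ₗ WithLp.sndₗ 2 ℂ _ _))
  cont := by
    refine (WithLp.prodContinuousLinearEquiv 2 ℂ (StrainSpace A)
      (MomentumSpace M hM)).symm.continuous.comp (continuous_const.prodMk ?_)
    exact (MomentumSpace.continuous_of hM).comp (D.continuous.comp ((continuous_velocity hM).comp
      (WithLp.sndL 2 ℂ (StrainSpace A) (MomentumSpace M hM)).continuous))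

theorem inner_damping (z z' : WithLp 2 (StrainSpace A × MomentumSpace M hM)) :
    inner ℂ z (damping A M D hM z') =
      inner ℂ (velocity M hM z.snd) (D (velocity M hM z'.snd)) := by
  rw [WithLp.prod_inner_apply]
  change inner ℂ z.fst 0 + inner ℂ z.snd (MomentumSpace.of M hM (D (velocity M hM z'.snd))) = _
  rw [inner_zero_right, zero_add, MomentumSpace.inner_of_right]

theorem inner_strainMomentum (z : WithLp 2 (StrainSpace A × MomentumSpace M hM))
    (z' : (strainMomentum A B M D hM).domain) :
    inner ℂ z (strainMomentum A B M D hM z') =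
      inner ℂ (z.fst : Y) (A ⟨velocity M hM z'.1.snd, z'.2.2⟩) +
        inner ℂ (velocity M hM z.snd)
          (B ⟨z'.1.fst, z'.2.1⟩ - D (velocity M hM z'.1.snd)) := by
  rw [strainMomentum_apply, WithLp.prod_inner_apply]
  change inner ℂ z.fst _ + inner ℂ z.snd (MomentumSpace.of M hM
    (B ⟨z'.1.fst, z'.2.1⟩ - D (velocity M hM z'.1.snd))) = _
  rw [MomentumSpace.inner_of_right]
  rfl

end StrainMomentum

/-! ### The boundary maps form a dissipative triplet. -/

namespace DualPairTriplet

variable {X Y G₁ G₂ : Type*}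
  [NormedAddCommGroup X] [InnerProductSpace ℂ X] [CompleteSpace X]
  [NormedAddCommGroup Y] [InnerProductSpace ℂ Y]
  [NormedAddCommGroup G₁] [InnerProductSpace ℂ G₁] [CompleteSpace G₁]
  [NormedAddCommGroup G₂] [InnerProductSpace ℂ G₂] [CompleteSpace G₂]
  {A : X →ₗ.[ℂ] Y} {B : Y →ₗ.[ℂ] X} (t : DualPairTriplet A B G₁ G₂)

omit [CompleteSpace X] [CompleteSpace G₁] [CompleteSpace G₂] in
-- Sum of the Green identity at (y', v) and the conjugate of the one at (y, v').
theorem green_Ξ (y y' : (strainRestrict A B).domain) (v v' : A.domain) :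
    starRingEnd ℂ (t.Ξ₁ (y, v) (t.Ξ₀ (y', v'))) + t.Ξ₁ (y', v') (t.Ξ₀ (y, v)) =
      inner ℂ (B (inclB A B y)) (v' : X) + inner ℂ (y : StrainSpace A).1 (A v') +
        (inner ℂ (v : X) (B (inclB A B y')) + inner ℂ (A v) (y' : StrainSpace A).1) := by
  have h1 := t.green (inclB A B y') v
  have h2 := congrArg (starRingEnd ℂ) (t.green (inclB A B y) v')
  simp only [map_sub, map_neg, inner_conj_symm, Complex.conj_conj] at h2
  have e1 : ∀ y v y' v', t.Ξ₁ (y, v) (t.Ξ₀ (y', v')) =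
      -t.pi₁ (inclB A B y) (t.lam₁ v') + t.lam₂ v (t.pi₂ (inclB A B y')) := fun _ _ _ _ => rfl
  have e2 : ∀ y, ((inclB A B y : B.domain) : Y) = (y : StrainSpace A).1 := fun _ => rfl
  rw [e1, e1, map_add, map_neg]
  rw [e2] at h1 h2
  linear_combination h1 + h2

/-- The boundary maps of the strain–momentum operator. -/
theorem isDissipativeTriplet [CompleteSpace Y] (hA_closed : A.IsClosed)
    (hA_dense : Dense (A.domain : Set X)) (hS : IsUniformlyPositive (stiffness A))
    (hB_closed : B.IsClosed) (hAB : A.adjoint ≤ -B) {M D : X →L[ℂ] X}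
    (hM : IsBddUniformlyPositive M) (hD : ∀ x : X, 0 ≤ RCLike.re (inner ℂ x (D x))) :
    IsDissipativeTriplet (strainMomentum A B M D hM)
      ((riesz (WithLp 2 (G₁ × G₂))).toLinearEquiv.toLinearMap ∘ₗ t.Ξ₀ ∘ₗ scale A B M D hM)
      (t.Ξ₁ ∘ₗ scale A B M D hM) := by
  have hrange := isClosed_strainSpace hA_closed hA_dense hS
  refine ⟨strainMomentum_isClosed A B M D hM hA_closed hB_closed, fun a b => ?_,
    ⟨damping A M D hM, fun z => ?_, fun z z' => ?_⟩, fun μ hμ f => ?_⟩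
  · obtain ⟨g, rfl⟩ := (riesz (WithLp 2 (G₁ × G₂))).surjective a
    obtain ⟨φ₁, φ₂, rfl⟩ := antiDualProd_surjective b
    obtain ⟨x, hx1, hx2⟩ := t.exists_lam_eq g.fst φ₂
    obtain ⟨y, hy1, hy2⟩ := t.exists_pi_inclB_eq hAB hA_dense hrange (-φ₁) g.snd
    -- The momentum M x is chosen so that its velocity is x.
    have hv : velocity M hM (MomentumSpace.of M hM (M x)) = x := massInv_mass hM x
    let z : (strainMomentum A B M D hM).domain :=
      ⟨WithLp.toLp 2 (y, MomentumSpace.of M hM (M x)), y.2, by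
        change velocity M hM (MomentumSpace.of M hM (M x)) ∈ A.domain
        rw [hv]
        exact x.2⟩
    have hz : scale A B M D hM z = (y, x) := Prod.ext rfl (Subtype.ext hv)
    refine ⟨z, ?_, ?_⟩
    · change riesz _ (t.Ξ₀ (scale A B M D hM z)) = _
      rw [hz]
      congr 1
      exact (WithLp.linearEquiv 2 ℂ _).injective (Prod.ext hx1 hy2)
    · change t.Ξ₁ (scale A B M D hM z) = _
      rw [hz]
      change antiDualProd G₁ G₂ (-t.pi₁ (inclB A B y), t.lam₂ x) = _
      rw [hy1, hx2, neg_neg]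
  · rw [inner_damping]
    exact hD _
  · have h1 : ∀ w w' : (strainMomentum A B M D hM).domain,
        inner ℂ (strainMomentum A B M D hM w) (w' : WithLp 2 (StrainSpace A × MomentumSpace M hM))
          = starRingEnd ℂ (inner ℂ (w' : WithLp 2 (StrainSpace A × MomentumSpace M hM))
            (strainMomentum A B M D hM w)) := fun w w' => (inner_conj_symm _ _).symm
    have h2 : inner ℂ (damping A M D hM z) (z' : WithLp 2 (StrainSpace A × MomentumSpace M hM)) =
        starRingEnd ℂ (inner ℂ (z' : WithLp 2 (StrainSpace A × MomentumSpace M hM))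
          (damping A M D hM z)) := (inner_conj_symm _ _).symm
    rw [h1, h2, inner_damping, inner_damping, inner_strainMomentum, inner_strainMomentum]
    simp only [map_add, inner_conj_symm, inner_sub_right, map_sub]
    have h3 := t.green_Ξ (scale A B M D hM z).1 (scale A B M D hM z').1
      (scale A B M D hM z).2 (scale A B M D hM z').2
    refine (congrArg₂ (· + ·) (inner_riesz_right _ _) (inner_riesz_left _ _)).trans
      (h3.trans ?_)
    change inner ℂ (B ⟨z.1.fst, z.2.1⟩) (velocity M hM z'.1.snd) +
      inner ℂ (z.1.fst : Y) (A ⟨velocity M hM z'.1.snd, z'.2.2⟩) +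
      (inner ℂ (velocity M hM z.1.snd) (B ⟨z'.1.fst, z'.2.1⟩) +
        inner ℂ (A ⟨velocity M hM z.1.snd, z.2.2⟩) (z'.1.fst : Y)) = _
    ring
  · obtain ⟨c, hc, hMc⟩ := hM.2
    -- In the velocity x the resolvent equation reads μy - Ax = f₁ and (μM + D)x - By = f₂, with
    -- coercivity constant μc from M. The boundary conditions supplied are the two components of Γ₀z
    -- + Γ₁z = 0.
    obtain ⟨x, y, h1, h2, h3, h4⟩ := t.exists_stationary hAB hA_dense hA_closed
      (N := (μ : ℂ) • M + D) (c := μ * c) (by positivity) (fun x => by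
        have h : inner ℂ x (((μ : ℂ) • M + D) x) = inner ℂ x ((μ : ℂ) • M x) + inner ℂ x (D x) :=
          inner_add_right _ _ _
        rw [h, map_add, re_inner_ofReal_smul, mul_assoc]
        have := mul_le_mul_of_nonneg_left (hMc x) hμ.le
        linarith [hD x]) hμ f.fst ((MomentumSpace.of M hM).symm f.snd)
    have hμ0 : (μ : ℂ) ≠ 0 := by exact_mod_cast hμ.ne'
    -- The stationary problem was solved in Y; its first row puts y back into the strain space.
    have hy : (y : Y) ∈ LinearMap.range A.toFun := by
      have h5 : (μ : ℂ) • (y : Y) ∈ LinearMap.range A.toFun := by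
        rw [h1]
        exact Submodule.add_mem _ f.fst.2 ⟨x, rfl⟩
      simpa only [inv_smul_smul₀ hμ0] using Submodule.smul_mem _ (μ : ℂ)⁻¹ h5
    have hv : velocity M hM (MomentumSpace.of M hM (M x)) = x := massInv_mass hM x
    let z : (strainMomentum A B M D hM).domain :=
      ⟨WithLp.toLp 2 (⟨y, hy⟩, MomentumSpace.of M hM (M x)), y.2, by
        change velocity M hM (MomentumSpace.of M hM (M x)) ∈ A.domain
        rw [hv]
        exact x.2⟩
    have hz : scale A B M D hM z = (⟨⟨y, hy⟩, y.2⟩, x) := Prod.ext rfl (Subtype.ext hv)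
    refine ⟨z, ?_, ?_⟩
    · have hx : (⟨velocity M hM z.1.snd, z.2.2⟩ : A.domain) = x := Subtype.ext hv
      rw [strainMomentum_apply, hx]
      refine (WithLp.linearEquiv 2 ℂ _).injective (Prod.ext (Subtype.ext ?_) ?_)
      · change (μ : ℂ) • (y : Y) - A x = f.fst
        rw [h1, add_sub_cancel_right]
      · change (μ : ℂ) • MomentumSpace.of M hM (M x) - MomentumSpace.of M hM
          (B y - D (velocity M hM (MomentumSpace.of M hM (M x)))) = f.snd
        rw [hv, ← map_smul, ← map_sub, ← LinearEquiv.eq_symm_apply, ← h2]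
        change _ = (μ : ℂ) • M x + D x - B y
        abel
    · change riesz _ (t.Ξ₀ (scale A B M D hM z)) + t.Ξ₁ (scale A B M D hM z) = 0
      rw [hz]
      ext g
      change riesz _ (WithLp.toLp 2 (t.lam₁ x, t.pi₂ y)) g +
        antiDualProd G₁ G₂ (-t.pi₁ y, t.lam₂ x) g = 0
      have h5 : t.lam₂ x = -riesz G₂ (t.pi₂ y) := by rw [h4, neg_neg]
      rw [antiDualProd_apply, riesz_apply, WithLp.prod_inner_apply, h3, h5]
      change inner ℂ g.fst (t.lam₁ x) + inner ℂ g.snd (t.pi₂ y) +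
        (-inner ℂ g.fst (t.lam₁ x) + -inner ℂ g.snd (t.pi₂ y)) = 0
      ring

end DualPairTriplet

/-- Self-adjointness gives R*R = R² = A*A, so the comparison of forms applies in both directions. -/
theorem exists_energySpace_equiv {X Y : Type*} [NormedAddCommGroup X] [InnerProductSpace ℂ X]
    [CompleteSpace X] [NormedAddCommGroup Y] [InnerProductSpace ℂ Y] [CompleteSpace Y]
    {A : X →ₗ.[ℂ] Y} (hA_closed : A.IsClosed) (hA_dense : Dense (A.domain : Set X))
    (hS : IsUniformlyPositive (stiffness A)) {R : X →ₗ.[ℂ] X} (hR : IsSqrtOf R (stiffness A)) :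
    ∃ e : R.domain ≃ₗ[ℂ] EnergySpace A hS,
      (∀ x, (((EnergySpace.of A hS).symm (e x) : A.domain) : X) = x) ∧ ∀ x, ‖e x‖ = ‖R x‖ := by
  have hRS : stiffness R = stiffness A := by
    have h : R.adjoint = R := hR.1
    rw [← hR.2.2, stiffness, h]
  have hAR := mem_domain_of_stiffness_eq hA_closed hA_dense hS hR.1.isClosed hR.1.dense_domain hRS
  have hRA := mem_domain_of_stiffness_eq hR.1.isClosed hR.1.dense_domain (hRS ▸ hS) hA_closed
    hA_dense hRS.symm
  have hdom : R.domain = A.domain :=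
    le_antisymm (fun x hx => (hRA ⟨x, hx⟩).1) fun x hx => (hAR ⟨x, hx⟩).1
  refine ⟨(LinearEquiv.ofEq _ _ hdom).trans (EnergySpace.of A hS), fun x => rfl, fun x => ?_⟩
  obtain ⟨hx, h⟩ := hRA x
  rw [← h, ← (strainIso A hS).norm_map]
  rfl

end BoundaryNode

end

open BoundaryNode in
theorem theorem3p10 {X Y G₁ G₂ : Type*}
    [NormedAddCommGroup X] [InnerProductSpace ℂ X] [CompleteSpace X]
    [NormedAddCommGroup Y] [InnerProductSpace ℂ Y] [CompleteSpace Y]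
    [NormedAddCommGroup G₁] [InnerProductSpace ℂ G₁] [CompleteSpace G₁]
    [NormedAddCommGroup G₂] [InnerProductSpace ℂ G₂] [CompleteSpace G₂]
    (A : X →ₗ.[ℂ] Y) (hA_closed : A.IsClosed) (hA_dense : Dense (A.domain : Set X))
    (hS : IsUniformlyPositive (stiffness A))
    (B : Y →ₗ.[ℂ] X) (hB_closed : B.IsClosed) (hB_dense : Dense (B.domain : Set Y))
    (hAB : A.adjoint ≤ -B)
    (t : DualPairTriplet A B G₁ G₂)
    (M : X →L[ℂ] X) (hM : IsBddUniformlyPositive M)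
    (D : X →L[ℂ] X) (hD : ∀ x : X, 0 ≤ RCLike.re (inner ℂ x (D x)))
    (P : AntiDual (WithLp 2 (G₁ × G₂)) →L[ℂ] AntiDual (WithLp 2 (G₁ × G₂))) (hP : ‖P‖ ≤ 1) :
    (∀ R : X →ₗ.[ℂ] X, IsSqrtOf R (stiffness A) →
      ∃ e : R.domain ≃ₗ[ℂ] EnergySpace A hS,
        (∀ x, (((EnergySpace.of A hS).symm (e x) : A.domain) : X) = x) ∧ ∀ x, ‖e x‖ = ‖R x‖) ∧
    conjugate (diagIso A M hS hM).toLinearEquiv (positionMomentum A B M D hS hM) =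
      strainMomentum A B M D hM ∧
    (t.strainColligation M D hM P).IsInternallyWellPosed ∧
    (t.strainColligation M D hM P).IsImpedancePassive := by
  have ht := t.isDissipativeTriplet hA_closed hA_dense hS hB_closed hAB hM hD
  have : CompleteSpace (StrainSpace A) :=
    (isClosed_strainSpace hA_closed hA_dense hS).completeSpace_coe
  have : CompleteSpace (MomentumSpace M hM) := MomentumSpace.completeSpace hM
  exact ⟨fun R hR => exists_energySpace_equiv hA_closed hA_dense hS hR,
    conjugate_positionMomentum A B M D hM hS,
    ht.isImpedancePassive hP (fun _ => rfl) fun _ => rfl⟩
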